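/- Let $(U_p)_{p\ \mathrm{prime}}$ be i.i.d. random variables, uniform on the unit circle of $\mathbb{C}$. For $T\ge 3$, $\alpha\in[0,1]$ and $h\in[0,1]$ put $$W_p(h)=\frac{\mathrm{Re}(U_p\,p^{-ih})}{p^{1/2}},\qquad X_h=\sum_{p\le T}W_p(h),\qquad X_h(\alpha)=\sum_{p\le \exp((\log T)^{\alpha})}W_p(h),$$ where the sums are over primes (the dependence on $T$ is implicit). Let $$\rho(h,h')=\frac{\mathbb{E}[X_hX_{h'}]}{\sqrt{\mathbb{E}[X_h^2]\,\mathbb{E}[X_{h'}^2]}},\qquad h,h'\in[0,1],$$ and, for $\beta>0$, let $G_{\beta,T}$ be the random probability measure on $[0,1]$ with density $h\mapsto e^{\beta X_h}/\int_0^1 e^{\beta X_{h'}}\,dh'$. For $n\ge 1$ write $\mathbb{E}\,G_{\beta,T}^{\times n}[F]$ for the expectation of the integral of $F(h_1,\dots,h_n)$ (which may also depend on the randomness) against the product measure $G_{\beta,T}^{\times n}$. Let $\beta>0$, $s\ge 1$ an integer, and $M\ge 0$. There are constants $C$ and $T_0$, depending only on $\beta$, $s$ and $M$, such that for all $T\ge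 T_0$, all $0\le\alpha\le 1$, all $k\in\{1,\dots,s\}$ and all measurable $\phi:[0,1]^s\to\mathbb{R}$ with $|\phi|\le M$, writing $\mathbf{h}=(h_1,\dots,h_s)$, $$\left|\frac1\beta\cdot\frac{\mathbb{E}\,G_{\beta,T}^{\times s}\big[X_{h_k}(\alpha)\,\phi(\mathbf{h})\big]}{\frac12\log\log T}-\left\{\sum_{l=1}^{s}\mathbb{E}\,G_{\beta,T}^{\times s}\Big[\int_0^{\alpha}\mathbf{1}_{\{y<\rho(h_k,h_l)\}}dy\;\phi(\mathbf{h})\Big]-s\,\mathbb{E}\,G_{\beta,T}^{\times(s+1)}\Big[\int_0^{\alpha}\mathbf{1}_{\{y<\rho(h_k,h_{s+1})\}}dy\;\phi(\mathbf{h})\Big]\right\}\right|\le\frac{C}{\log\log T}.$$ -/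

import Mathlib

open MeasureTheory ProbabilityTheory unitInterval

namespace RandomZeta

/-- The uniform distribution on the unit circle of `ℂ`: the law of `exp (2 π i θ)` with `θ` uniform
on `[0,1]`. -/
noncomputable def uniformCircle : Measure ℂ :=
  (volume : Measure I).map fun θ : I => Complex.exp (2 * Real.pi * (θ : ℝ) * Complex.I)

/-- The primes `p` with `p ≤ x`, for real `x`. -/
noncomputable def primesLE (x : ℝ) : Finset Nat.Primes :=
  (Finset.Iic ⌊x⌋₊).subtype Nat.Prime

theorem mem_primesLE {x : ℝ} {p : Nat.Primes} : p ∈ primesLE x ↔ ((p : ℕ) : ℝ) ≤ x := by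
  have h : p ∈ primesLE x ↔ (p : ℕ) ∈ Finset.Iic ⌊x⌋₊ := Finset.mem_subtype
  rw [h, Finset.mem_Iic, Nat.le_floor_iff' p.2.ne_zero]

variable {Ω : Type*} [MeasurableSpace Ω]

/-- `(U p)`, `p` prime, are i.i.d. random variables, uniform on the unit circle of `ℂ`. -/
structure IsIIDUniformCircle (P : Measure Ω) (U : Nat.Primes → Ω → ℂ) : Prop where
  measurable : ∀ p, Measurable (U p)
  indep : iIndepFun U P
  law : ∀ p, P.map (U p) = uniformCircle

/-- `W_p(h) = Re (U_p p^{-ih}) / p^{1/2}`. -/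
noncomputable def W (U : Nat.Primes → Ω → ℂ) (p : Nat.Primes) (h : I) (ω : Ω) : ℝ :=
  (U p ω * ((p : ℕ) : ℂ) ^ (-(Complex.I * ((h : ℝ) : ℂ)))).re / ((p : ℕ) : ℝ) ^ (1 / 2 : ℝ)

/-- The field `X_h = ∑_{p ≤ T} W_p(h)`. -/
noncomputable def X (U : Nat.Primes → Ω → ℂ) (T : ℝ) (h : I) (ω : Ω) : ℝ :=
  ∑ p ∈ primesLE T, W U p h ω

/-- The truncated field `X_h(α)`: the sum of `W_p(h)` over the primes `p ≤ exp ((log T)^α)`. -/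
noncomputable def truncX (U : Nat.Primes → Ω → ℂ) (T α : ℝ) (h : I) (ω : Ω) : ℝ :=
  ∑ p ∈ primesLE (Real.exp (Real.log T ^ α)), W U p h ω

/-- The overlap `ρ(h,h') = E[X_h X_{h'}] / √(E[X_h²] E[X_{h'}²])`. -/
noncomputable def overlap (P : Measure Ω) (U : Nat.Primes → Ω → ℂ) (T : ℝ) (h h' : I) : ℝ :=
  (∫ ω, X U T h ω * X U T h' ω ∂P) /
    √((∫ ω, X U T h ω ^ 2 ∂P) * (∫ ω, X U T h' ω ^ 2 ∂P))

/-- The (random) Gibbs measure on `[0,1]`, with density `exp (β X_h) / ∫ exp (β X_{h'}) dh'` with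
respect to Lebesgue measure. -/
noncomputable def gibbs (U : Nat.Primes → Ω → ℂ) (β T : ℝ) (ω : Ω) : Measure I :=
  (volume : Measure I).withDensity fun h =>
    ENNReal.ofReal (Real.exp (β * X U T h ω) / ∫ h' : I, Real.exp (β * X U T h' ω))

/-- The averaged Gibbs expectation `E G^{×n}[F]` of an observable `F (h, ω)` of `n` points
(replicas) `h : Fin n → [0,1]` and of the randomness `ω`. -/
noncomputable def EG (P : Measure Ω) (U : Nat.Primes → Ω → ℂ) (β T : ℝ) (n : ℕ)
    (F : (Fin n → I) → Ω → ℝ) : ℝ :=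
  ∫ ω, (∫ h, F h ω ∂(Measure.pi fun _ : Fin n => gibbs U β T ω)) ∂P

/-- `∫_0^α 1_{y < r} dy`. -/
noncomputable def cutoff (α r : ℝ) : ℝ :=
  ∫ y in (0 : ℝ)..α, {y : ℝ | y < r}.indicator (fun _ => (1 : ℝ)) y

end RandomZeta

/-! The proof is an approximate Gaussian integration by parts, carried out one prime at a time,
followed by a comparison of covariances.

Fix `p` and put `w = p^(-1/2)`. Multiplying `U_p` by a power of `i` preserves the joint law, so `E
G[W_p φ]` may be averaged over the four rotations. With the other phases frozen, a rotation tilts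
the Gibbs measure by a function of size at most `2βw`. Replica averages are expanded to first order
in this tilt (`abs_integral_pi_tilted_sub_le`). The zeroth-order term vanishes, since the four
values of `Re (i^j z)` sum to zero. The first-order term is `β` times the replica combination of the
covariances `cos(|h-h'| log p)/(2p)`; normalization of the tilt creates the replica `s+1`. The error
is `O(w^3)`, because the observable contributes one more factor `w`, and `p^(-3/2)` is summable
(`abs_EG_W_sub_gibbsForm_le`, `abs_EG_truncX_sub_gibbsForm_le`).

It remains to evaluate `∑_{p ≤ x} cos(δ log p)/p`, which is `-log max(1/log x, δ) + O(1)` by the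
simple pole of zeta at `1` and its nonvanishing on `Re s ≥ 1` (`exists_abs_cosSum_add_log_max_le`).
With `L = log log T`, taking `x = T` shows that `L ρ` has this form, and `x = exp((log T)^α)` caps
it at `αL`. The truncated covariance is thus `(L/2) min(α, max(ρ, 0)) + O(1)`
(`exists_abs_cosSum_sub_le`), and `min(α, max(ρ, 0))` is the integral of the indicator. Dividing by
`L/2` leaves `O(1/L)`. -/

namespace RandomZeta

/-! ### Zeta near `1` and cosine sums over primes -/

/-- The entire extension of `(s - 1) ζ(s)` is continuous. -/
theorem continuous_update_sub_one_mul_riemannZeta :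
    Continuous (Function.update (fun s : ℂ => (s - 1) * riemannZeta s) 1 1) := by
  rw [continuous_iff_continuousAt]
  intro s
  by_cases hs : s = 1
  · subst hs
    exact continuousAt_update_same.mpr riemannZeta_residue_one
  · rw [continuousAt_update_of_ne hs]
    exact (continuousAt_id.sub continuousAt_const).mul
      (differentiableAt_riemannZeta hs).continuousAt

/-- The function `(s - 1) ζ(s)` is continuous and zero-free on a compact rectangle touching the line
`Re s = 1`, so its log-modulus is bounded there. The pole factor `|τ + iδ|` is `max τ δ` up to a
factor `2`, whence the extra `log 2`. -/
theorem exists_abs_log_norm_riemannZeta_add_log_max_le :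
    ∃ C : ℝ, ∀ τ δ : ℝ, 0 < τ → τ ≤ 2 → 0 ≤ δ → δ ≤ 1 →
      |Real.log ‖riemannZeta (1 + τ + δ * Complex.I)‖ + Real.log (max τ δ)| ≤ C := by
  set g := Function.update (fun s : ℂ => (s - 1) * riemannZeta s) 1 1 with hg
  have hK : IsCompact (Set.Icc (1 : ℝ) 3 ×ℂ Set.Icc (0 : ℝ) 1) :=
    isCompact_Icc.reProdIm isCompact_Icc
  have hcont : ContinuousOn (fun s => Real.log ‖g s‖) (Set.Icc (1 : ℝ) 3 ×ℂ Set.Icc (0 : ℝ) 1) := by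
    refine ContinuousOn.log continuous_update_sub_one_mul_riemannZeta.norm.continuousOn ?_
    intro s hs
    rw [norm_ne_zero_iff]
    by_cases h1 : s = 1
    · simp [hg, h1]
    · rw [hg, Function.update_of_ne h1]
      exact mul_ne_zero (sub_ne_zero.mpr h1) (riemannZeta_ne_zero_of_one_le_re hs.1.1)
  obtain ⟨C, hC⟩ := hK.exists_bound_of_continuousOn hcont
  refine ⟨C + Real.log 2, fun τ δ hτ hτ2 hδ hδ1 => ?_⟩
  have hmem : (1 + τ + δ * Complex.I : ℂ) ∈ Set.Icc (1 : ℝ) 3 ×ℂ Set.Icc (0 : ℝ) 1 := by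
    rw [Complex.mem_reProdIm]
    simp only [Complex.add_re, Complex.one_re, Complex.ofReal_re, Complex.mul_re, Complex.I_re,
      mul_zero, Complex.ofReal_im, Complex.I_im, mul_one, sub_self, add_zero, Complex.add_im,
      Complex.one_im, Complex.mul_im, zero_add, Set.mem_Icc]
    refine ⟨⟨?_, ?_⟩, ?_, ?_⟩ <;> linarith
  have hne : (1 + τ + δ * Complex.I : ℂ) ≠ 1 := by
    intro h
    have := congrArg Complex.re h
    simp at this
    exact hτ.ne' this
  have h1 := hC _ hmem
  have hζ : riemannZeta (1 + τ + δ * Complex.I) ≠ 0 :=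
    riemannZeta_ne_zero_of_one_le_re hmem.1.1
  have hsub : (1 + τ + δ * Complex.I : ℂ) - 1 = τ + δ * Complex.I := by ring
  have hne' : (τ + δ * Complex.I : ℂ) ≠ 0 := hsub ▸ sub_ne_zero.mpr hne
  have hm : 0 < max τ δ := lt_max_of_lt_left hτ
  have hlow : max τ δ ≤ ‖(τ + δ * Complex.I : ℂ)‖ := by
    refine max_le ?_ ?_
    · simpa [abs_of_pos hτ] using Complex.abs_re_le_norm (τ + δ * Complex.I : ℂ)
    · simpa [abs_of_nonneg hδ] using Complex.abs_im_le_norm (τ + δ * Complex.I : ℂ)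
  have hup : ‖(τ + δ * Complex.I : ℂ)‖ ≤ 2 * max τ δ := by
    refine (norm_add_le _ _).trans ?_
    rw [norm_mul, Complex.norm_I, Complex.norm_of_nonneg hτ.le, Complex.norm_of_nonneg hδ]
    linarith [le_max_left τ δ, le_max_right τ δ]
  rw [hg, Function.update_of_ne hne, hsub, norm_mul,
    Real.log_mul (norm_ne_zero_iff.mpr hne') (norm_ne_zero_iff.mpr hζ), Real.norm_eq_abs] at h1
  have h2 := Real.log_le_log hm hlow
  have h3 := Real.log_le_log (hm.trans_le hlow) hup
  rw [Real.log_mul two_ne_zero hm.ne'] at h3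
  rw [abs_le] at h1 ⊢
  constructor <;> linarith [h1.1, h1.2, Real.log_nonneg one_le_two]

theorem re_natCast_cpow_neg {n : ℕ} (hn : 0 < n) (a δ : ℝ) :
    ((n : ℂ) ^ (-(a + δ * Complex.I : ℂ))).re = (n : ℝ) ^ (-a) * Real.cos (δ * Real.log n) := by
  have h0 : (n : ℂ) ≠ 0 := by exact_mod_cast hn.ne'
  rw [Complex.cpow_def_of_ne_zero h0, Complex.exp_re, ← Complex.natCast_log,
    Real.rpow_def_of_pos (by exact_mod_cast hn)]
  simp only [Complex.mul_re, Complex.mul_im, Complex.neg_re, Complex.neg_im, Complex.add_re,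
    Complex.add_im, Complex.ofReal_re, Complex.ofReal_im, Complex.I_re, Complex.I_im, mul_zero,
    zero_mul, sub_zero, add_zero, zero_add, mul_one]
  rw [mul_neg, mul_neg, Real.cos_neg, mul_comm δ]

theorem summable_primes_rpow_neg {a : ℝ} (ha : 1 < a) :
    Summable fun p : Nat.Primes => ((p : ℕ) : ℝ) ^ (-a) :=
  Nat.Primes.summable_rpow.mpr (by linarith)

theorem summable_primes_rpow_mul_cos {a : ℝ} (ha : 1 < a) (δ : ℝ) :
    Summable fun p : Nat.Primes =>
      ((p : ℕ) : ℝ) ^ (-a) * Real.cos (δ * Real.log (p : ℕ)) := by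
  refine (summable_primes_rpow_neg ha).of_norm_bounded fun p => ?_
  rw [norm_mul, Real.norm_of_nonneg (by positivity)]
  exact mul_le_of_le_one_right (by positivity) (Real.abs_cos_le_one _)

/-- In the logarithm of the Euler product, the terms beyond the linear one are dominated by `∑
p^(-2)`, uniformly in `τ` and `δ`. -/
theorem exists_abs_log_norm_riemannZeta_sub_tsum_le :
    ∃ C : ℝ, ∀ τ δ : ℝ, 0 < τ →
      |Real.log ‖riemannZeta (1 + τ + δ * Complex.I)‖ -
        ∑' p : Nat.Primes, ((p : ℕ) : ℝ) ^ (-(1 + τ)) * Real.cos (δ * Real.log (p : ℕ))| ≤ C := by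
  refine ⟨∑' p : Nat.Primes, ((p : ℕ) : ℝ) ^ (-2 : ℝ), fun τ δ hτ => ?_⟩
  set s : ℂ := 1 + τ + δ * Complex.I with hs
  have hs' : s = ((1 + τ : ℝ) : ℂ) + δ * Complex.I := by rw [hs]; push_cast; ring
  have hre : s.re = 1 + τ := by simp [hs]
  have hs1 : 1 < s.re := by linarith
  have hnorm (p : Nat.Primes) : ‖((p : ℕ) : ℂ) ^ (-s)‖ = ((p : ℕ) : ℝ) ^ (-(1 + τ)) := by
    rw [Complex.norm_natCast_cpow_of_pos p.2.pos, Complex.neg_re, hre]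
  have hsum : Summable fun p : Nat.Primes => ((p : ℕ) : ℂ) ^ (-s) := by
    refine Summable.of_norm ?_
    simp only [hnorm]
    exact summable_primes_rpow_neg (by linarith)
  have hlog : Real.log ‖riemannZeta s‖ =
      ∑' p : Nat.Primes, (-Complex.log (1 - ((p : ℕ) : ℂ) ^ (-s))).re := by
    rw [← riemannZeta_eulerProduct_exp_log hs1, Complex.norm_exp, Real.log_exp,
      Complex.re_tsum hsum.clog_one_sub.neg]
  have hsumre := (Complex.hasSum_re hsum.clog_one_sub.neg.hasSum).summable
  have hcos := summable_primes_rpow_mul_cos (a := 1 + τ) (by linarith) δ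
  rw [hlog, ← hsumre.tsum_sub hcos, ← Real.norm_eq_abs]
  refine tsum_of_norm_bounded
    (summable_primes_rpow_neg (a := 2) (by norm_num)).hasSum fun p => ?_
  rw [← re_natCast_cpow_neg p.2.pos, ← hs', ← Complex.sub_re, Real.norm_eq_abs]
  have hp2 : (2 : ℝ) ≤ (p : ℕ) := by exact_mod_cast p.2.two_le
  have hle : ((p : ℕ) : ℝ) ^ (-(1 + τ)) ≤ ((p : ℕ) : ℝ) ^ (-1 : ℝ) :=
    Real.rpow_le_rpow_of_exponent_le (by linarith) (by linarith)
  have hinv : ((p : ℕ) : ℝ) ^ (-1 : ℝ) ≤ 1 / 2 := by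
    rw [Real.rpow_neg_one, one_div]
    exact inv_anti₀ two_pos hp2
  have hz : ‖((p : ℕ) : ℂ) ^ (-s)‖ ≤ 1 / 2 := by rw [hnorm]; exact hle.trans hinv
  have hz1 : ‖((p : ℕ) : ℂ) ^ (-s)‖ < 1 := by linarith
  have hmain := Complex.norm_log_one_sub_inv_sub_self_le hz1
  have harg : (1 - ((p : ℕ) : ℂ) ^ (-s)).arg ≠ Real.pi := by
    refine Complex.slitPlane_arg_ne_pi ?_
    rw [sub_eq_add_neg]
    exact Complex.mem_slitPlane_of_norm_lt_one (by rwa [norm_neg])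
  rw [Complex.log_inv _ harg] at hmain
  refine (Complex.abs_re_le_norm _).trans (hmain.trans ?_)
  have h2 : (1 - ‖((p : ℕ) : ℂ) ^ (-s)‖)⁻¹ ≤ 2 := by
    rw [inv_le_comm₀ (by linarith) two_pos]; linarith
  have h3 : ‖((p : ℕ) : ℂ) ^ (-s)‖ ^ 2 ≤ ((p : ℕ) : ℝ) ^ (-2 : ℝ) := by
    have : ((p : ℕ) : ℝ) ^ (-2 : ℝ) = (((p : ℕ) : ℝ) ^ (-1 : ℝ)) ^ 2 := by
      rw [← Real.rpow_natCast, ← Real.rpow_mul (by positivity)]; norm_num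
    rw [this, hnorm]
    exact pow_le_pow_left₀ (by positivity) hle 2
  calc ‖((p : ℕ) : ℂ) ^ (-s)‖ ^ 2 * (1 - ‖((p : ℕ) : ℂ) ^ (-s)‖)⁻¹ / 2
      ≤ ‖((p : ℕ) : ℂ) ^ (-s)‖ ^ 2 * 2 / 2 := by gcongr
    _ ≤ _ := by linarith

theorem exists_abs_tsum_primes_add_log_max_le :
    ∃ C : ℝ, ∀ τ δ : ℝ, 0 < τ → τ ≤ 2 → 0 ≤ δ → δ ≤ 1 →
      |∑' p : Nat.Primes, ((p : ℕ) : ℝ) ^ (-(1 + τ)) * Real.cos (δ * Real.log (p : ℕ)) +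
        Real.log (max τ δ)| ≤ C := by
  obtain ⟨C₁, h₁⟩ := exists_abs_log_norm_riemannZeta_add_log_max_le
  obtain ⟨C₂, h₂⟩ := exists_abs_log_norm_riemannZeta_sub_tsum_le
  refine ⟨C₁ + C₂, fun τ δ hτ hτ2 hδ hδ1 => ?_⟩
  have h1 := abs_le.mp (h₁ τ δ hτ hτ2 hδ hδ1)
  have h2 := abs_le.mp (h₂ τ δ hτ)
  rw [abs_le]
  constructor <;> linarith [h1.1, h1.2, h2.1, h2.2]

/-- The sum `∑_{p ≤ x} cos (δ log p) / p` over primes. -/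
noncomputable def cosSum (x δ : ℝ) : ℝ :=
  ∑ p ∈ primesLE x, Real.cos (δ * Real.log (p : ℕ)) / (p : ℕ)

/-- The sharp cutoff at `x` is exchanged for the smooth weight `p^(-τ)` with `τ = 1/log x`. No
Tauberian argument is needed: the error is dominated termwise by a difference of two smooth sums. -/
theorem exists_abs_cosSum_add_log_max_le :
    ∃ C : ℝ, ∀ x δ : ℝ, Real.exp 1 ≤ x → 0 ≤ δ → δ ≤ 1 →
      |cosSum x δ + Real.log (max (Real.log x)⁻¹ δ)| ≤ C := by
  obtain ⟨C, hC⟩ := exists_abs_tsum_primes_add_log_max_le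
  refine ⟨C + 3 * (2 * C + Real.log 2), fun x δ hx hδ hδ1 => ?_⟩
  have hx0 : 0 < x := (Real.exp_pos 1).trans_le hx
  have hlog1 : 1 ≤ Real.log x := by rwa [Real.le_log_iff_exp_le hx0]
  set τ := (Real.log x)⁻¹ with hτdef
  have hτ : 0 < τ := by positivity
  have hτ1 : τ ≤ 1 := inv_le_one_of_one_le₀ hlog1
  have hsum1 := summable_primes_rpow_neg (a := 1 + τ) (by linarith)
  have hsum2 := summable_primes_rpow_neg (a := 1 + 2 * τ) (by linarith)
  have hcos := summable_primes_rpow_mul_cos (a := 1 + τ) (by linarith) δ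
  -- At `δ = 0` the main terms are `-log τ` and `-log (2τ)`, which differ by `log 2` whatever `τ`
  -- is.
  have hgap : ∑' p : Nat.Primes, (((p : ℕ) : ℝ) ^ (-(1 + τ)) - ((p : ℕ) : ℝ) ^ (-(1 + 2 * τ))) ≤
      2 * C + Real.log 2 := by
    rw [hsum1.tsum_sub hsum2]
    have h1 := abs_le.mp (hC τ 0 hτ (by linarith) le_rfl zero_le_one)
    have h2 := abs_le.mp (hC (2 * τ) 0 (by linarith) (by linarith) le_rfl zero_le_one)
    simp only [zero_mul, Real.cos_zero, mul_one] at h1 h2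
    rw [max_eq_left hτ.le] at h1
    rw [max_eq_left (by linarith), Real.log_mul two_ne_zero hτ.ne'] at h2
    linarith [h1.2, h2.1]
  have hdiff : |cosSum x δ -
      ∑' p : Nat.Primes, ((p : ℕ) : ℝ) ^ (-(1 + τ)) * Real.cos (δ * Real.log (p : ℕ))| ≤
      3 * (2 * C + Real.log 2) := by
    classical
    have hfin : HasSum (fun p : Nat.Primes => if p ∈ primesLE x then
        Real.cos (δ * Real.log (p : ℕ)) / (p : ℕ) else 0) (cosSum x δ) := by
      have : HasSum _ _ := hasSum_sum_of_ne_finset_zero (L := .unconditional _) (f := fun p : Nat.Primes => if p ∈ primesLE x then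
        Real.cos (δ * Real.log (p : ℕ)) / (p : ℕ) else 0) (s := primesLE x)
        (fun p hp => if_neg hp)
      rwa [Finset.sum_congr rfl fun p hp => if_pos hp] at this
    rw [← hfin.tsum_eq, ← hfin.summable.tsum_sub hcos, ← Real.norm_eq_abs]
    -- With `q = p^(-τ)`, the condition `p ≤ x` reads `q ≥ 1/e`. The error is at most `(1-q)/p` for
    -- `p ≤ x` and `q/p` beyond. Both are at most `3q(1-q)/p`, since `3q ≥ 1` in the first case and
    -- `3(1-q) ≥ 1` in the second.
    refine (tsum_of_norm_bounded ((hsum1.sub hsum2).mul_left 3).hasSum fun p => ?_).trans ?_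
    · have hp0 : (0 : ℝ) < (p : ℕ) := by exact_mod_cast p.2.pos
      have e1 : ((p : ℕ) : ℝ) ^ (-(1 + τ)) = ((p : ℕ) : ℝ)⁻¹ * ((p : ℕ) : ℝ) ^ (-τ) := by
        rw [← Real.rpow_neg_one, ← Real.rpow_add hp0]; ring_nf
      have e2 : ((p : ℕ) : ℝ) ^ (-(1 + 2 * τ)) =
          ((p : ℕ) : ℝ)⁻¹ * (((p : ℕ) : ℝ) ^ (-τ) * ((p : ℕ) : ℝ) ^ (-τ)) := by
        rw [← Real.rpow_neg_one, ← Real.rpow_add hp0, ← Real.rpow_add hp0]; ring_nf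
      have hq : ((p : ℕ) : ℝ) ^ (-τ) = Real.exp (-(Real.log (p : ℕ) * τ)) := by
        rw [Real.rpow_def_of_pos hp0]; ring_nf
      have hlogx : Real.log x * τ = 1 := mul_inv_cancel₀ (by linarith)
      have hlogp : 0 ≤ Real.log (p : ℕ) := Real.log_nonneg (by exact_mod_cast p.2.one_le)
      rw [e1, e2]
      set q := ((p : ℕ) : ℝ) ^ (-τ)
      have hq0 : 0 < q := by rw [hq]; positivity
      have hq1 : q ≤ 1 := by
        rw [hq, Real.exp_le_one_iff]
        have := mul_nonneg hlogp hτ.le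
        linarith
      have he : Real.exp (-1) * Real.exp 1 = 1 := by rw [← Real.exp_add]; simp
      have he3 : Real.exp 1 < 2.7182818286 := Real.exp_one_lt_d9
      have he4 : 2.7182818283 < Real.exp 1 := Real.exp_one_gt_d9
      have hc := Real.abs_cos_le_one (δ * Real.log (p : ℕ))
      have hpi : (0 : ℝ) < ((p : ℕ) : ℝ)⁻¹ := by positivity
      split_ifs with hmem
      · have hpx := mem_primesLE.mp hmem
        have hqe : Real.exp (-1) ≤ q := by
          rw [hq, Real.exp_le_exp, neg_le_neg_iff, ← hlogx]
          exact mul_le_mul_of_nonneg_right (Real.log_le_log hp0 hpx) hτ.le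
        have hq3 : 1 ≤ 3 * q := by nlinarith
        have : Real.cos (δ * Real.log (p : ℕ)) / (p : ℕ) -
            ((p : ℕ) : ℝ)⁻¹ * q * Real.cos (δ * Real.log (p : ℕ)) =
            (((p : ℕ) : ℝ)⁻¹ * (1 - q)) * Real.cos (δ * Real.log (p : ℕ)) := by
          rw [div_eq_mul_inv]; ring
        rw [this, norm_mul, Real.norm_of_nonneg (mul_nonneg hpi.le (by linarith))]
        calc _ ≤ ((p : ℕ) : ℝ)⁻¹ * (1 - q) * 1 :=
              mul_le_mul_of_nonneg_left hc (mul_nonneg hpi.le (by linarith))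
          _ ≤ ((p : ℕ) : ℝ)⁻¹ * (1 - q) * (3 * q) :=
              mul_le_mul_of_nonneg_left hq3 (mul_nonneg hpi.le (by linarith))
          _ = _ := by ring
      · have hpx : x < (p : ℕ) := by
          rw [mem_primesLE] at hmem; exact not_le.mp hmem
        have hqe : q ≤ Real.exp (-1) := by
          rw [hq, Real.exp_le_exp, neg_le_neg_iff, ← hlogx]
          exact mul_le_mul_of_nonneg_right (Real.log_le_log hx0 hpx.le) hτ.le
        have hq3 : 1 ≤ 3 * (1 - q) := by nlinarith
        rw [zero_sub, norm_neg, norm_mul, Real.norm_of_nonneg (mul_nonneg hpi.le hq0.le)]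
        calc _ ≤ ((p : ℕ) : ℝ)⁻¹ * q * 1 :=
              mul_le_mul_of_nonneg_left hc (mul_nonneg hpi.le hq0.le)
          _ ≤ ((p : ℕ) : ℝ)⁻¹ * q * (3 * (1 - q)) :=
              mul_le_mul_of_nonneg_left hq3 (mul_nonneg hpi.le hq0.le)
          _ = _ := by ring
    · rw [tsum_mul_left]
      linarith
  have h1 := abs_le.mp (hC τ δ hτ (by linarith) hδ hδ1)
  have h2 := abs_le.mp hdiff
  rw [abs_le]
  constructor <;> linarith [h1.1, h1.2, h2.1, h2.2]


/-! ### Product measures under small tilts -/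

theorem abs_exp_sub_one_sub_self_le (x : ℝ) :
    |Real.exp x - 1 - x| ≤ x ^ 2 * Real.exp |x| := by
  have h := Complex.norm_exp_sub_sum_le_norm_mul_exp (x : ℂ) 2
  have e : Complex.exp x - ∑ m ∈ Finset.range 2, (x : ℂ) ^ m / (m.factorial : ℂ) =
      ((Real.exp x - 1 - x : ℝ) : ℂ) := by
    simp [Finset.sum_range_succ]; ring
  rw [e, Complex.norm_real, Complex.norm_real] at h
  simpa using h

section Tilted

variable {α ι : Type*} [MeasurableSpace α] [Fintype ι]

theorem pi_tilted (μ : Measure α) [IsProbabilityMeasure μ] (g : α → ℝ) :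
    Measure.pi (fun _ : ι => μ.tilted g) =
      (Measure.pi fun _ : ι => μ).tilted fun h => ∑ l, g (h l) := by
  refine Measure.pi_eq fun s hs => ?_
  have hz : ∫ h : ι → α, Real.exp (∑ l, g (h l)) ∂(Measure.pi fun _ => μ) =
      ∏ _l : ι, ∫ a, Real.exp (g a) ∂μ := by
    simp_rw [Real.exp_sum]
    exact integral_fintype_prod_eq_prod (fun (_ : ι) a => Real.exp (g a))
  rw [tilted_apply_eq_ofReal_integral' _ (MeasurableSet.univ_pi hs), Measure.restrict_pi_pi, hz]
  simp_rw [Real.exp_sum, ← Finset.prod_div_distrib]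
  rw [integral_fintype_prod_eq_prod (fun (_ : ι) a => Real.exp (g a) / ∫ a, Real.exp (g a) ∂μ),
    ENNReal.ofReal_prod_of_nonneg fun i _ => integral_nonneg fun a => by positivity]
  exact Finset.prod_congr rfl fun i _ => (tilted_apply_eq_ofReal_integral' _ (hs i)).symm

variable {μ : Measure α} [IsProbabilityMeasure μ] {g : α → ℝ} {K : ℝ}

theorem integrable_of_abs_le {β : Type*} [MeasurableSpace β] {ν : Measure β} [IsFiniteMeasure ν]
    {f : β → ℝ} (hf : Measurable f) {B : ℝ} (hB : ∀ x, |f x| ≤ B) : Integrable f ν :=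
  .of_bound hf.aestronglyMeasurable B (ae_of_all _ hB)

theorem abs_integral_le_of_abs_le {β : Type*} [MeasurableSpace β] {ν : Measure β}
    [IsProbabilityMeasure ν] {f : β → ℝ} {B : ℝ} (hB : ∀ x, |f x| ≤ B) : |∫ x, f x ∂ν| ≤ B := by
  simpa using norm_integral_le_of_norm_le_const (f := f) (μ := ν) (ae_of_all _ hB)

theorem integrable_exp_of_abs_le (hg : Measurable g) (hK : ∀ a, |g a| ≤ K) :
    Integrable (fun a => Real.exp (g a)) μ :=
  integrable_of_abs_le hg.exp (B := Real.exp K) fun a => by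
    rw [abs_of_pos (Real.exp_pos _)]
    exact Real.exp_le_exp.mpr ((le_abs_self _).trans (hK a))

/-- The cumulant `log ∫ exp g` agrees with the mean `∫ g` up to second order. -/
theorem abs_log_integral_exp_sub_integral_le (hg : Measurable g) (hK : ∀ a, |g a| ≤ K) :
    |Real.log (∫ a, Real.exp (g a) ∂μ) - ∫ a, g a ∂μ| ≤ K ^ 2 * Real.exp K := by
  have hi := integrable_exp_of_abs_le (μ := μ) hg hK
  have hgi := integrable_of_abs_le (ν := μ) hg hK
  have hz : 0 < ∫ a, Real.exp (g a) ∂μ := integral_exp_pos hi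
  have hup : ∫ a, Real.exp (g a) ∂μ ≤ 1 + ∫ a, g a ∂μ + K ^ 2 * Real.exp K := by
    calc ∫ a, Real.exp (g a) ∂μ ≤ ∫ a, (1 + g a + K ^ 2 * Real.exp K) ∂μ := by
          refine integral_mono hi (((integrable_const _).add hgi).add (integrable_const _))
            fun a => ?_
          have h1 := (abs_le.mp (abs_exp_sub_one_sub_self_le (g a))).2
          have h2 : g a ^ 2 * Real.exp |g a| ≤ K ^ 2 * Real.exp K := by
            rw [← sq_abs]
            have := hK a
            gcongr
          simp only
          linarith
      _ = _ := by
          have h1 : Integrable (fun a => 1 + g a) μ := (integrable_const _).add hgi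
          rw [integral_add h1 (integrable_const _), integral_add (integrable_const _) hgi]
          simp
  -- Jensen's inequality, by integrating `1 + u ≤ exp u` at `u = g - ∫ g`.
  have hlow : Real.exp (∫ a, g a ∂μ) ≤ ∫ a, Real.exp (g a) ∂μ := by
    have h1 : 1 ≤ ∫ a, Real.exp (g a - ∫ a, g a ∂μ) ∂μ := by
      calc (1 : ℝ) = ∫ a, (g a - ∫ a, g a ∂μ + 1) ∂μ := by
            have h1 : Integrable (fun a => g a - ∫ a, g a ∂μ) μ := hgi.sub (integrable_const _)
            rw [integral_add h1 (integrable_const _), integral_sub hgi (integrable_const _)]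
            simp
        _ ≤ _ := by
            refine integral_mono ((hgi.sub (integrable_const _)).add (integrable_const _)) ?_
              fun a => Real.add_one_le_exp _
            simp_rw [Real.exp_sub]
            exact hi.div_const _
    simp_rw [Real.exp_sub] at h1
    rwa [integral_div, one_le_div (Real.exp_pos _)] at h1
  rw [abs_le]
  constructor
  · have := (Real.le_log_iff_exp_le hz).mpr hlow
    have : 0 ≤ K ^ 2 * Real.exp K := by positivity
    linarith
  · linarith [Real.log_le_sub_one_of_pos hz]

/-- First-order expansion of replica averages under a small tilt of the underlying measure. -/
theorem abs_integral_pi_tilted_sub_le (hg : Measurable g) (hK : ∀ a, |g a| ≤ K)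
    {f : (ι → α) → ℝ} (hf : Measurable f) {B : ℝ} (hB : ∀ h, |f h| ≤ B) :
    |∫ h, f h ∂(Measure.pi fun _ : ι => μ.tilted g) -
        ∫ h, f h * (1 + (∑ l, g (h l) - Fintype.card ι * ∫ a, g a ∂μ))
          ∂(Measure.pi fun _ : ι => μ)| ≤
      B * (((2 * Fintype.card ι) ^ 2 * Real.exp (2 * Fintype.card ι * K) +
        Fintype.card ι * Real.exp K) * K ^ 2) := by
  set n : ℝ := (Fintype.card ι : ℝ) with hn
  have hn0 : 0 ≤ n := Nat.cast_nonneg _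
  have hi := integrable_exp_of_abs_le (μ := μ) hg hK
  have hz : 0 < ∫ a, Real.exp (g a) ∂μ := integral_exp_pos hi
  set z := ∫ a, Real.exp (g a) ∂μ with hzdef
  set m := ∫ a, g a ∂μ with hm
  obtain ⟨a₀⟩ : Nonempty α := nonempty_of_isProbabilityMeasure μ
  have hK0 : 0 ≤ K := (abs_nonneg _).trans (hK a₀)
  have hlam : |Real.log z| ≤ K := by
    rw [abs_le]
    constructor
    · rw [Real.le_log_iff_exp_le hz]
      calc Real.exp (-K) = ∫ _a, Real.exp (-K) ∂μ := by simp
        _ ≤ z := integral_mono (integrable_const _) hi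
          fun a => Real.exp_le_exp.mpr (abs_le.mp (hK a)).1
    · rw [Real.log_le_iff_le_exp hz]
      calc z ≤ ∫ _a, Real.exp K ∂μ := integral_mono hi (integrable_const _)
            fun a => Real.exp_le_exp.mpr (abs_le.mp (hK a)).2
        _ = Real.exp K := by simp
  have hcum := abs_log_integral_exp_sub_integral_le (μ := μ) hg hK
  have hZ : ∫ h : ι → α, Real.exp (∑ l, g (h l)) ∂(Measure.pi fun _ => μ) =
      Real.exp (n * Real.log z) := by
    simp_rw [Real.exp_sum]
    rw [integral_fintype_prod_eq_pow (fun a => Real.exp (g a)), hn, Real.exp_nat_mul,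
      Real.exp_log hz]
  rw [pi_tilted, integral_tilted, hZ]
  have hsum (h : ι → α) : |∑ l, g (h l)| ≤ n * K := by
    refine (Finset.abs_sum_le_sum_abs _ _).trans ((Finset.sum_le_sum fun l _ => hK (h l)).trans ?_)
    simp [hn]
  have hpt (h : ι → α) : |f h * (Real.exp (∑ l, g (h l) - n * Real.log z) -
      (1 + (∑ l, g (h l) - n * m)))| ≤
      B * (((2 * n) ^ 2 * Real.exp (2 * n * K) + n * Real.exp K) * K ^ 2) := by
    rw [abs_mul]
    refine mul_le_mul (hB h) ?_ (abs_nonneg _) ((abs_nonneg _).trans (hB h))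
    set S := ∑ l, g (h l)
    have hu : |S - n * Real.log z| ≤ 2 * n * K := by
      have h1 := abs_sub S (n * Real.log z)
      rw [abs_mul, abs_of_nonneg hn0] at h1
      have h2 := mul_le_mul_of_nonneg_left hlam hn0
      linarith [hsum h]
    have h1 := abs_exp_sub_one_sub_self_le (S - n * Real.log z)
    have h2 : (S - n * Real.log z) ^ 2 * Real.exp |S - n * Real.log z| ≤
        (2 * n * K) ^ 2 * Real.exp (2 * n * K) := by
      rw [← sq_abs]
      gcongr
    have h3 := mul_le_mul_of_nonneg_left hcum hn0
    have h4 : n * |Real.log z - m| = |n * (Real.log z - m)| := by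
      rw [abs_mul, abs_of_nonneg hn0]
    rw [h4] at h3
    -- Two second-order errors: the Taylor remainder of the exponential, and the replacement of the
    -- cumulant `log z` by the mean `m`, once for each of the `n` replicas.
    have e : Real.exp (S - n * Real.log z) - (1 + (S - n * m)) =
        (Real.exp (S - n * Real.log z) - 1 - (S - n * Real.log z)) -
          n * (Real.log z - m) := by ring
    rw [e]
    refine (abs_sub _ _).trans ?_
    calc _ ≤ (2 * n * K) ^ 2 * Real.exp (2 * n * K) + n * (K ^ 2 * Real.exp K) := by
          linarith
      _ = _ := by ring
  have hgs : Measurable fun h : ι → α => ∑ l, g (h l) :=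
    Finset.measurable_sum _ fun l _ => hg.comp (measurable_pi_apply l)
  have hB0 : 0 ≤ B := (abs_nonneg _).trans (hB fun _ => a₀)
  have hi1 : Integrable (fun h : ι → α => f h * Real.exp (∑ l, g (h l) - n * Real.log z))
      (Measure.pi fun _ => μ) := by
    refine integrable_of_abs_le (hf.mul (hgs.sub_const _).exp)
      (B := B * Real.exp (n * K - n * Real.log z)) fun h => ?_
    rw [abs_mul, abs_of_pos (Real.exp_pos _)]
    have := (abs_le.mp (hsum h)).2
    have := hB h
    gcongr
  have hi2 : Integrable (fun h : ι → α => f h * (1 + (∑ l, g (h l) - n * m)))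
      (Measure.pi fun _ => μ) := by
    refine integrable_of_abs_le (hf.mul ((hgs.sub_const _).const_add _))
      (B := B * (1 + (n * K + |n * m|))) fun h => ?_
    rw [abs_mul]
    refine mul_le_mul (hB h) ?_ (abs_nonneg _) hB0
    refine (abs_add_le _ _).trans ?_
    have := abs_sub (∑ l, g (h l)) (n * m)
    have := hsum h
    rw [abs_one]
    linarith
  have e : ∫ h : ι → α, (Real.exp (∑ l, g (h l)) / Real.exp (n * Real.log z)) • f h
      ∂(Measure.pi fun _ => μ) =
      ∫ h : ι → α, f h * Real.exp (∑ l, g (h l) - n * Real.log z) ∂(Measure.pi fun _ => μ) := by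
    refine integral_congr_ae (ae_of_all _ fun h => ?_)
    simp only [smul_eq_mul, Real.exp_sub]
    ring
  rw [e, ← integral_sub hi1 hi2]
  simp_rw [← mul_sub]
  exact abs_integral_le_of_abs_le hpt

end Tilted

/-- Splitting off the last replica. -/
theorem integral_pi_castSucc_mul_last {α : Type*} [MeasurableSpace α] (μ : Measure α)
    [IsProbabilityMeasure μ] (n : ℕ) (f : (Fin n → α) → ℝ) (g : α → ℝ) :
    ∫ h, f (fun i => h i.castSucc) * g (h (Fin.last n)) ∂(Measure.pi fun _ : Fin (n + 1) => μ) =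
      (∫ h, f h ∂(Measure.pi fun _ : Fin n => μ)) * ∫ a, g a ∂μ := by
  have hmp := measurePreserving_piFinSuccAbove (fun _ : Fin (n + 1) => μ) (Fin.last n)
  have := hmp.integral_comp' (fun q : α × (Fin n → α) => g q.1 * f q.2)
  rw [integral_prod_mul g f] at this
  rw [mul_comm, ← this]
  refine integral_congr_ae (ae_of_all _ fun h => ?_)
  simp [MeasurableEquiv.piFinSuccAbove, Fin.insertNthEquiv, Fin.init_def, mul_comm]

/-- `∑_l A (h_k, h_l) φ - s A (h_k, h_{s+1}) φ`, averaged over independent replicas from `μ`. -/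
noncomputable def replicaForm {α : Type*} [MeasurableSpace α] (μ : Measure α) {s : ℕ}
    (A : α → α → ℝ) (k : Fin s) (φ : (Fin s → α) → ℝ) : ℝ :=
  ∑ l, ∫ h, A (h k) (h l) * φ h ∂(Measure.pi fun _ : Fin s => μ) -
    s * ∫ h, A (h k.castSucc) (h (Fin.last s)) * φ (fun i => h i.castSucc)
      ∂(Measure.pi fun _ : Fin (s + 1) => μ)

/-! ### Averaging over the four rotations -/

section Rotation

theorem sum_re_I_pow_mul (z : ℂ) : ∑ j : Fin 4, (Complex.I ^ (j : ℕ) * z).re = 0 := by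
  have h3 : Complex.I ^ 3 = -Complex.I := by rw [pow_succ, Complex.I_sq]; ring
  simp [Fin.sum_univ_four, h3]

/-- Four rotations already reproduce the first two moments of a uniform phase, so a finite sum can
replace an integral over the circle. -/
theorem sum_re_I_pow_mul_mul_re (z z' : ℂ) :
    ∑ j : Fin 4, (Complex.I ^ (j : ℕ) * z).re * (Complex.I ^ (j : ℕ) * z').re =
      2 * (z * (starRingEnd ℂ) z').re := by
  have h3 : Complex.I ^ 3 = -Complex.I := by rw [pow_succ, Complex.I_sq]; ring
  simp [Fin.sum_univ_four, h3]
  ring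

theorem abs_re_I_pow_mul_le {z : ℂ} (hz : ‖z‖ = 1) (j : ℕ) : |(Complex.I ^ j * z).re| ≤ 1 :=
  (Complex.abs_re_le_norm _).trans (by simp [hz])

/-- Constant of the rotation-averaged integration by parts. -/
noncomputable def ibpConst (β : ℝ) (s : ℕ) (M : ℝ) : ℝ :=
  M * (((2 * s) ^ 2 * Real.exp (2 * s * (2 * β)) + s * Real.exp (2 * β)) * (2 * β) ^ 2)

/-- Approximate Gaussian integration by parts: averaging over the four rotations of a unit-modulus
field `z`, under the tilts that they induce. -/
theorem abs_sum_integral_rotation_sub_le {α : Type*} [MeasurableSpace α] {μ : Measure α}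
    [IsProbabilityMeasure μ] {z : α → ℂ} (hz : Measurable z) (hz1 : ∀ a, ‖z a‖ = 1) {β w M : ℝ}
    (hβ : 0 ≤ β) (hw : 0 ≤ w) (hw1 : w ≤ 1) {s : ℕ} (k : Fin s) {φ : (Fin s → α) → ℝ}
    (hφ : Measurable φ) (hM : ∀ h, |φ h| ≤ M) :
    |(∑ j : Fin 4, ∫ h, w * (Complex.I ^ (j : ℕ) * z (h k)).re * φ h ∂(Measure.pi fun _ : Fin s =>
        μ.tilted fun a => β * (w * (Complex.I ^ (j : ℕ) * z a).re - w * (z a).re))) / 4 -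
      β * replicaForm μ (fun a b => w ^ 2 / 2 * (z a * (starRingEnd ℂ) (z b)).re) k φ| ≤
      ibpConst β s M * w ^ 3 := by
  set r : Fin 4 → α → ℝ := fun j a => (Complex.I ^ (j : ℕ) * z a).re with hr
  have hrm (j : Fin 4) : Measurable (r j) := Complex.measurable_re.comp (hz.const_mul _)
  have hr1 (j : Fin 4) (a : α) : |r j a| ≤ 1 := abs_re_I_pow_mul_le (hz1 a) j
  have hr0 (a : α) : r 0 a = (z a).re := by simp [hr]
  set g : Fin 4 → α → ℝ := fun j a => β * (w * r j a - w * (z a).re) with hg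
  have hgm (j : Fin 4) : Measurable (g j) :=
    (((hrm j).const_mul _).sub ((Complex.measurable_re.comp hz).const_mul _)).const_mul _
  have hgK (j : Fin 4) (a : α) : |g j a| ≤ 2 * β * w := by
    have h0 := hr1 0 a
    rw [hr0] at h0
    have e : g j a = β * w * (r j a - (z a).re) := by simp only [hg]; ring
    rw [e, abs_mul, abs_of_nonneg (mul_nonneg hβ hw)]
    have h1 : |r j a - (z a).re| ≤ 2 := by
      have := abs_sub (r j a) (z a).re
      linarith [hr1 j a]
    nlinarith [mul_nonneg hβ hw]
  obtain ⟨a₀⟩ : Nonempty α := nonempty_of_isProbabilityMeasure μ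
  have hM0 : 0 ≤ M := (abs_nonneg _).trans (hM fun _ => a₀)
  set f : Fin 4 → (Fin s → α) → ℝ := fun j h => w * r j (h k) * φ h with hf
  have hfm (j : Fin 4) : Measurable (f j) :=
    (((hrm j).comp (measurable_pi_apply k)).const_mul _).mul hφ
  have hfB (j : Fin 4) (h : Fin s → α) : |f j h| ≤ w * M := by
    simp only [hf]
    rw [abs_mul, abs_mul, abs_of_nonneg hw]
    have h1 := hr1 j (h k)
    have h2 := hM h
    calc w * |r j (h k)| * |φ h| ≤ w * 1 * M := by gcongr
      _ = w * M := by ring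
  set π := Measure.pi fun _ : Fin s => μ
  set π' := Measure.pi fun _ : Fin (s + 1) => μ
  -- The mean of the tilt, coming from normalization, is rewritten as an evaluation at an
  -- independent replica `s+1`.
  have hlast (j : Fin 4) : ∫ h, f j (fun i => h i.castSucc) * g j (h (Fin.last s)) ∂π' =
      (∫ h, f j h ∂π) * ∫ a, g j a ∂μ := integral_pi_castSucc_mul_last μ s (f j) (g j)
  have hfi (j : Fin 4) : Integrable (f j) π := integrable_of_abs_le (hfm j) (hfB j)
  have hfgm (j : Fin 4) (l : Fin s) : Measurable fun h : Fin s → α => f j h * g j (h l) :=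
    (hfm j).mul ((hgm j).comp (measurable_pi_apply l))
  have hfgi (j : Fin 4) (l : Fin s) : Integrable (fun h : Fin s → α => f j h * g j (h l)) π := by
    refine integrable_of_abs_le (hfgm j l) (B := w * M * (2 * β * w)) fun h => ?_
    rw [abs_mul]
    exact mul_le_mul (hfB j h) (hgK j _) (abs_nonneg _) (by positivity)
  have hlasti (j : Fin 4) : Integrable (fun h : Fin (s + 1) → α =>
      f j (fun i => h i.castSucc) * g j (h (Fin.last s))) π' := by
    have hm : Measurable fun (h : Fin (s + 1) → α) (i : Fin s) => h i.castSucc :=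
      measurable_pi_lambda _ fun i => measurable_pi_apply _
    refine integrable_of_abs_le (((hfm j).comp hm).mul
      ((hgm j).comp (measurable_pi_apply (Fin.last s)))) (B := w * M * (2 * β * w)) fun h => ?_
    rw [abs_mul]
    exact mul_le_mul (hfB j fun i => h i.castSucc) (hgK j _) (abs_nonneg _) (by positivity)
  have hexp (j : Fin 4) : ∫ h, f j h * (1 + (∑ l, g j (h l) -
      Fintype.card (Fin s) * ∫ a, g j a ∂μ)) ∂π =
      ∫ h, f j h ∂π + ∑ l, ∫ h, f j h * g j (h l) ∂π -
        s * ∫ h, f j (fun i => h i.castSucc) * g j (h (Fin.last s)) ∂π' := by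
    have hsi : Integrable (fun h => ∑ l, f j h * g j (h l)) π :=
      integrable_finsetSum _ fun l _ => hfgi j l
    have hti : Integrable (fun h => f j h + ∑ l, f j h * g j (h l)) π := (hfi j).add hsi
    rw [hlast, ← integral_finsetSum _ fun l _ => hfgi j l, ← integral_add (hfi j) hsi,
      ← mul_assoc, mul_comm (s : ℝ), mul_assoc, ← integral_mul_const,
      ← integral_sub hti ((hfi j).mul_const _)]
    refine integral_congr_ae (ae_of_all _ fun h => ?_)
    simp only [Fintype.card_fin, ← Finset.mul_sum]
    ring
  -- The subtracted `(z b).re` does not depend on `j`, so it is killed by the vanishing first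
  -- moment.
  have havg (a b : α) : ∑ j, r j a * (r j b - (z b).re) =
      2 * (z a * (starRingEnd ℂ) (z b)).re := by
    simp_rw [mul_sub, Finset.sum_sub_distrib, ← Finset.sum_mul]
    simp only [hr]
    rw [sum_re_I_pow_mul_mul_re, sum_re_I_pow_mul]
    ring
  have h0 : ∑ j, ∫ h, f j h ∂π = 0 := by
    rw [← integral_finsetSum _ fun j _ => hfi j]
    have (h : Fin s → α) : ∑ j, f j h = 0 := by
      simp only [hf, ← Finset.sum_mul, ← Finset.mul_sum]
      rw [sum_re_I_pow_mul]; simp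
    simp [this]
  have h1 (l : Fin s) : ∑ j, ∫ h, f j h * g j (h l) ∂π =
      4 * (β * ∫ h, w ^ 2 / 2 * (z (h k) * (starRingEnd ℂ) (z (h l))).re * φ h ∂π) := by
    rw [← integral_finsetSum _ fun j _ => hfgi j l, ← integral_const_mul, ← integral_const_mul]
    refine integral_congr_ae (ae_of_all _ fun h => ?_)
    have e : ∑ j, f j h * g j (h l) =
        β * w ^ 2 * φ h * ∑ j, r j (h k) * (r j (h l) - (z (h l)).re) := by
      rw [Finset.mul_sum]
      exact Finset.sum_congr rfl fun j _ => by simp only [hf, hg]; ring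
    simp only [e, havg]
    ring
  have h2 : ∑ j, ∫ h, f j (fun i => h i.castSucc) * g j (h (Fin.last s)) ∂π' =
      4 * (β * ∫ h, w ^ 2 / 2 * (z (h k.castSucc) * (starRingEnd ℂ) (z (h (Fin.last s)))).re *
        φ (fun i => h i.castSucc) ∂π') := by
    rw [← integral_finsetSum _ fun j _ => hlasti j, ← integral_const_mul, ← integral_const_mul]
    refine integral_congr_ae (ae_of_all _ fun h => ?_)
    have e : ∑ j, f j (fun i => h i.castSucc) * g j (h (Fin.last s)) =
        β * w ^ 2 * φ (fun i => h i.castSucc) *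
          ∑ j, r j (h k.castSucc) * (r j (h (Fin.last s)) - (z (h (Fin.last s))).re) := by
      rw [Finset.mul_sum]
      exact Finset.sum_congr rfl fun j _ => by simp only [hf, hg]; ring
    simp only [e, havg]
    ring
  have hmain : β * replicaForm μ (fun a b => w ^ 2 / 2 * (z a * (starRingEnd ℂ) (z b)).re) k φ =
      (∑ j, ∫ h, f j h * (1 + (∑ l, g j (h l) -
        Fintype.card (Fin s) * ∫ a, g j a ∂μ)) ∂π) / 4 := by
    simp_rw [hexp, Finset.sum_sub_distrib, Finset.sum_add_distrib, ← Finset.mul_sum]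
    rw [h0, h2, Finset.sum_comm, Finset.sum_congr rfl fun l _ => h1 l, ← Finset.mul_sum,
      ← Finset.mul_sum, replicaForm]
    ring
  have hterm (j : Fin 4) : |∫ h, f j h ∂(Measure.pi fun _ : Fin s => μ.tilted (g j)) -
      ∫ h, f j h * (1 + (∑ l, g j (h l) - Fintype.card (Fin s) * ∫ a, g j a ∂μ)) ∂π| ≤
      ibpConst β s M * w ^ 3 := by
    -- Here `B = wM` and `K = 2βw`: the bound `B K²` yields the cube of `w`, and `w ≤ 1` is used
    -- only inside the exponentials.
    refine (abs_integral_pi_tilted_sub_le (μ := μ) (hgm j) (hgK j) (hfm j) (hfB j)).trans ?_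
    have hKw : 2 * β * w ≤ 2 * β := mul_le_of_le_one_right (by positivity) hw1
    rw [Fintype.card_fin, ibpConst]
    calc w * M * (((2 * s) ^ 2 * Real.exp (2 * s * (2 * β * w)) + s * Real.exp (2 * β * w)) *
          (2 * β * w) ^ 2)
        ≤ w * M * (((2 * s) ^ 2 * Real.exp (2 * s * (2 * β)) + s * Real.exp (2 * β)) *
          (2 * β * w) ^ 2) := by gcongr
      _ = _ := by ring
  rw [hmain, ← sub_div, ← Finset.sum_sub_distrib, abs_div, abs_of_pos (four_pos : (0 : ℝ) < 4),
    div_le_iff₀ four_pos]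
  refine (Finset.abs_sum_le_sum_abs _ _).trans ((Finset.sum_le_sum fun j _ => hterm j).trans ?_)
  simp [mul_comm]

end Rotation


/-! ### Rotation invariance of the uniform law on the circle -/

section UniformCircle

theorem measurable_circleMap :
    Measurable fun θ : I => Complex.exp (2 * Real.pi * (θ : ℝ) * Complex.I) := by
  fun_prop

instance : IsProbabilityMeasure uniformCircle :=
  Measure.isProbabilityMeasure_map measurable_circleMap.aemeasurable

theorem ae_norm_eq_one_uniformCircle : ∀ᵐ z ∂uniformCircle, ‖z‖ = 1 := by
  rw [uniformCircle, ae_map_iff measurable_circleMap.aemeasurable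
    (measurableSet_eq_fun measurable_norm measurable_const)]
  refine ae_of_all _ fun θ => ?_
  have : (2 * Real.pi * (θ : ℝ) * Complex.I : ℂ) = ((2 * Real.pi * (θ : ℝ) : ℝ) : ℂ) * Complex.I := by
    push_cast; ring
  rw [this, Complex.norm_exp_ofReal_mul_I]

/-- Identifies the law with the image of Haar measure on the additive circle, whose translation
invariance becomes rotation invariance. -/
theorem uniformCircle_eq_map_toCircle :
    uniformCircle = (volume : Measure UnitAddCircle).map fun x => (AddCircle.toCircle x : ℂ) := by
  have hc : Measurable fun x : UnitAddCircle => (AddCircle.toCircle x : ℂ) :=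
    (continuous_subtype_val.comp AddCircle.continuous_toCircle).measurable
  have hF : Measurable fun x : ℝ => Complex.exp (2 * Real.pi * x * Complex.I) := by fun_prop
  have h1 : (volume : Measure I).map Subtype.val =
      (volume : Measure ℝ).restrict (Set.Ioc (0 : ℝ) (0 + 1)) := by
    rw [zero_add, restrict_Ioc_eq_restrict_Icc]
    exact (measurePreserving_subtype_coe measurableSet_Icc).map_eq
  have h2 := (UnitAddCircle.measurePreserving_mk 0).map_eq
  rw [← h2, ← h1, Measure.map_map AddCircle.measurable_mk' measurable_subtype_coe,
    Measure.map_map hc (AddCircle.measurable_mk'.comp measurable_subtype_coe), uniformCircle]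
  congr 1
  ext θ
  simp [AddCircle.toCircle_apply_mk]

theorem map_toCircle_mul_uniformCircle (t : UnitAddCircle) :
    uniformCircle.map (fun z => (AddCircle.toCircle t : ℂ) * z) = uniformCircle := by
  have hc : Measurable fun x : UnitAddCircle => (AddCircle.toCircle x : ℂ) :=
    (continuous_subtype_val.comp AddCircle.continuous_toCircle).measurable
  conv_rhs => rw [uniformCircle_eq_map_toCircle, ← map_add_left_eq_self volume t]
  rw [uniformCircle_eq_map_toCircle, Measure.map_map (measurable_const_mul _) hc,
    Measure.map_map hc (measurable_const_add t)]
  congr 1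
  ext x
  simp [AddCircle.toCircle_add]

theorem map_I_pow_mul_uniformCircle (j : ℕ) :
    uniformCircle.map (fun z => Complex.I ^ j * z) = uniformCircle := by
  convert! map_toCircle_mul_uniformCircle (((j : ℝ) / 4 : ℝ) : UnitAddCircle) using 4
  rw [AddCircle.toCircle_apply_mk, Circle.coe_exp]
  have : ((2 * Real.pi / 1 * ((j : ℝ) / 4) : ℝ) : ℂ) * Complex.I =
      (j : ℕ) * (Real.pi / 2 * Complex.I) := by push_cast; ring
  rw [this, Complex.exp_nat_mul, Complex.exp_pi_div_two_mul_I]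

end UniformCircle

/-! ### The field and the Gibbs measure under rotation of one prime -/

section Field

set_option linter.unusedSectionVars false

variable {Ω : Type*} [MeasurableSpace Ω]

/-- The family obtained from `U` by multiplying `U p` by `c`. -/
noncomputable def rotate (U : Nat.Primes → Ω → ℂ) (p : Nat.Primes) (c : ℂ) :
    Nat.Primes → Ω → ℂ :=
  Function.update U p fun ω => c * U p ω

theorem rotate_self (U : Nat.Primes → Ω → ℂ) (p : Nat.Primes) (c : ℂ) :
    rotate U p c p = fun ω => c * U p ω :=
  Function.update_self ..

theorem rotate_of_ne (U : Nat.Primes → Ω → ℂ) {p q : Nat.Primes} (c : ℂ) (h : q ≠ p) :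
    rotate U p c q = U q :=
  Function.update_of_ne h ..

variable {P : Measure Ω} {U : Nat.Primes → Ω → ℂ}

theorem IsIIDUniformCircle.rotate (hU : IsIIDUniformCircle P U) (p : Nat.Primes) (j : ℕ) :
    IsIIDUniformCircle P (rotate U p (Complex.I ^ j)) := by
  have e (q : Nat.Primes) : RandomZeta.rotate U p (Complex.I ^ j) q =
      (fun z => (if q = p then Complex.I ^ j else 1) * z) ∘ U q := by
    by_cases h : q = p
    · subst h; rw [rotate_self]; ext; simp
    · rw [rotate_of_ne U _ h]; ext; simp [h]
  refine ⟨fun q => ?_, ?_, fun q => ?_⟩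
  · rw [e]; exact (measurable_const_mul _).comp (hU.measurable q)
  · have := hU.indep.comp (fun q z => (if q = p then Complex.I ^ j else 1) * z)
      fun q => measurable_const_mul _
    convert! this using 1
    exact funext e
  · rw [e, ← Measure.map_map (measurable_const_mul _) (hU.measurable q), hU.law]
    split_ifs
    · exact map_I_pow_mul_uniformCircle j
    · simp

theorem IsIIDUniformCircle.map_eq [IsProbabilityMeasure P] (hU : IsIIDUniformCircle P U) :
    P.map (fun ω q => U q ω) = Measure.infinitePi fun _ : Nat.Primes => uniformCircle := by
  rw [(iIndepFun_iff_map_fun_eq_infinitePi_map hU.measurable).mp hU.indep]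
  simp_rw [hU.law]

/-- The rotated family is again i.i.d. uniform, so both families have the same infinite product law.
-/
theorem IsIIDUniformCircle.integral_rotate [IsProbabilityMeasure P] (hU : IsIIDUniformCircle P U)
    (p : Nat.Primes) (j : ℕ) {Φ : (Nat.Primes → ℂ) → ℝ} (hΦ : StronglyMeasurable Φ) :
    ∫ ω, Φ (fun q => RandomZeta.rotate U p (Complex.I ^ j) q ω) ∂P =
      ∫ ω, Φ (fun q => U q ω) ∂P := by
  have hm := measurable_pi_lambda _ hU.measurable
  have hm' := measurable_pi_lambda _ (hU.rotate p j).measurable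
  rw [← integral_map hm.aemeasurable hΦ.aestronglyMeasurable,
    ← integral_map hm'.aemeasurable hΦ.aestronglyMeasurable, hU.map_eq, (hU.rotate p j).map_eq]

theorem IsIIDUniformCircle.ae_norm_eq_one (hU : IsIIDUniformCircle P U) :
    ∀ᵐ ω ∂P, ∀ p, ‖U p ω‖ = 1 := by
  rw [ae_all_iff]
  intro p
  have h := ae_norm_eq_one_uniformCircle
  rw [← hU.law p] at h
  exact ae_of_ae_map (hU.measurable p).aemeasurable h

theorem measurable_uncurry_W (hU : ∀ p, Measurable (U p)) (p : Nat.Primes) :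
    Measurable fun q : I × Ω => W U p q.1 q.2 := by
  have h0 : ((p : ℕ) : ℂ) ≠ 0 := by exact_mod_cast p.2.ne_zero
  have h1 : Continuous fun h : I => ((p : ℕ) : ℂ) ^ (-(Complex.I * ((h : ℝ) : ℂ))) :=
    Continuous.const_cpow (by fun_prop) (Or.inl h0)
  exact (Complex.measurable_re.comp (((hU p).comp measurable_snd).mul
    (h1.measurable.comp measurable_fst))).div_const _

theorem continuous_W (U : Nat.Primes → Ω → ℂ) (p : Nat.Primes) (ω : Ω) :
    Continuous fun h => W U p h ω := by
  have h0 : ((p : ℕ) : ℂ) ≠ 0 := by exact_mod_cast p.2.ne_zero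
  have h1 : Continuous fun h : I => ((p : ℕ) : ℂ) ^ (-(Complex.I * ((h : ℝ) : ℂ))) :=
    Continuous.const_cpow (by fun_prop) (Or.inl h0)
  exact (Complex.continuous_re.comp (continuous_const.mul h1)).div_const _

theorem measurable_uncurry_X (hU : ∀ p, Measurable (U p)) (T : ℝ) :
    Measurable fun q : I × Ω => X U T q.1 q.2 :=
  Finset.measurable_sum _ fun p _ => measurable_uncurry_W hU p

theorem continuous_X (U : Nat.Primes → Ω → ℂ) (T : ℝ) (ω : Ω) :
    Continuous fun h => X U T h ω :=
  continuous_finsetSum _ fun p _ => continuous_W U p ω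

theorem gibbs_eq_tilted (U : Nat.Primes → Ω → ℂ) (β T : ℝ) (ω : Ω) :
    gibbs U β T ω = (volume : Measure I).tilted fun h => β * X U T h ω :=
  rfl

theorem integrable_exp_X (U : Nat.Primes → Ω → ℂ) (β T : ℝ) (ω : Ω) :
    Integrable (fun h => Real.exp (β * X U T h ω)) (volume : Measure I) := by
  have hc : Continuous fun h => Real.exp (β * X U T h ω) :=
    Real.continuous_exp.comp ((continuous_X U T ω).const_mul β)
  obtain ⟨C, hC⟩ := isCompact_univ.exists_bound_of_continuousOn hc.continuousOn
  exact .of_bound hc.aestronglyMeasurable C (ae_of_all _ fun h => hC h trivial)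

instance (U : Nat.Primes → Ω → ℂ) (β T : ℝ) (ω : Ω) : IsProbabilityMeasure (gibbs U β T ω) :=
  isProbabilityMeasure_tilted (integrable_exp_X U β T ω)

/-- The measure varies with `ω`; writing the tilt as a density against the fixed `ν` reduces
measurability to that of parameter integrals. -/
theorem stronglyMeasurable_integral_tilted {γ : Type*} [MeasurableSpace γ] (ν : Measure γ)
    [SFinite ν] {Y F : γ → Ω → ℝ} (hY : Measurable fun q : γ × Ω => Y q.1 q.2)
    (hF : Measurable fun q : γ × Ω => F q.1 q.2) :
    StronglyMeasurable fun ω => ∫ x, F x ω ∂(ν.tilted fun x => Y x ω) := by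
  simp_rw [integral_tilted]
  have hZ : StronglyMeasurable fun ω => ∫ x, Real.exp (Y x ω) ∂ν :=
    StronglyMeasurable.integral_prod_left' (f := fun q : γ × Ω => Real.exp (Y q.1 q.2))
      hY.exp.stronglyMeasurable
  have : Measurable fun q : γ × Ω =>
      (Real.exp (Y q.1 q.2) / ∫ x, Real.exp (Y x q.2) ∂ν) • F q.1 q.2 :=
    (hY.exp.div (hZ.measurable.comp measurable_snd)).smul hF
  exact StronglyMeasurable.integral_prod_left'
    (f := fun q : γ × Ω => (Real.exp (Y q.1 q.2) / ∫ x, Real.exp (Y x q.2) ∂ν) • F q.1 q.2)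
    this.stronglyMeasurable

theorem stronglyMeasurable_integral_pi_gibbs (hU : ∀ p, Measurable (U p)) (β T : ℝ) {n : ℕ}
    {F : (Fin n → I) → Ω → ℝ} (hF : Measurable fun q : (Fin n → I) × Ω => F q.1 q.2) :
    StronglyMeasurable fun ω => ∫ h, F h ω ∂(Measure.pi fun _ : Fin n => gibbs U β T ω) := by
  simp_rw [gibbs_eq_tilted, pi_tilted]
  refine stronglyMeasurable_integral_tilted _ (Finset.measurable_sum _ fun l _ => ?_) hF
  have hl : Measurable fun q : (Fin n → I) × Ω => (q.1 l, q.2) :=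
    ((measurable_pi_apply l).comp measurable_fst).prodMk measurable_snd
  exact ((measurable_uncurry_X hU T).comp hl).const_mul β

/-- The weight `p ^ (-1/2)` of the prime `p`. -/
noncomputable def primeWeight (p : Nat.Primes) : ℝ := (((p : ℕ) : ℝ) ^ (1 / 2 : ℝ))⁻¹

theorem primeWeight_nonneg (p : Nat.Primes) : 0 ≤ primeWeight p := by
  rw [primeWeight]; positivity

theorem primeWeight_le_one (p : Nat.Primes) : primeWeight p ≤ 1 :=
  inv_le_one_of_one_le₀ (Real.one_le_rpow (by exact_mod_cast p.2.one_le) (by norm_num))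

theorem primeWeight_sq (p : Nat.Primes) : primeWeight p ^ 2 = ((p : ℕ) : ℝ)⁻¹ := by
  rw [primeWeight, inv_pow, ← Real.rpow_natCast, ← Real.rpow_mul (by positivity)]
  norm_num

theorem summable_primeWeight_pow_three : Summable fun p => primeWeight p ^ 3 := by
  have e (p : Nat.Primes) : primeWeight p ^ 3 = ((p : ℕ) : ℝ) ^ (-(3 / 2) : ℝ) := by
    rw [primeWeight, inv_pow, ← Real.rpow_natCast, ← Real.rpow_mul (by positivity),
      ← Real.rpow_neg (by positivity)]
    norm_num
  simp_rw [e]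
  exact summable_primes_rpow_neg (by norm_num)

/-- The phase `U_p p^{-ih}`. -/
noncomputable def phase (U : Nat.Primes → Ω → ℂ) (p : Nat.Primes) (ω : Ω) (h : I) : ℂ :=
  U p ω * ((p : ℕ) : ℂ) ^ (-(Complex.I * ((h : ℝ) : ℂ)))

theorem W_eq_primeWeight_mul (U : Nat.Primes → Ω → ℂ) (p : Nat.Primes) (h : I) (ω : Ω) :
    W U p h ω = primeWeight p * (phase U p ω h).re := by
  rw [W, primeWeight, phase, div_eq_inv_mul]

theorem W_rotate_self (U : Nat.Primes → Ω → ℂ) (p : Nat.Primes) (c : ℂ) (h : I) (ω : Ω) :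
    W (rotate U p c) p h ω = primeWeight p * (c * phase U p ω h).re := by
  rw [W_eq_primeWeight_mul, phase, rotate_self, phase, mul_assoc]

theorem W_rotate_of_ne (U : Nat.Primes → Ω → ℂ) {p q : Nat.Primes} (c : ℂ) (hq : q ≠ p) (h : I)
    (ω : Ω) : W (rotate U p c) q h ω = W U q h ω := by
  rw [W, rotate_of_ne U c hq, W]

theorem norm_phase {p : Nat.Primes} {ω : Ω} (hω : ‖U p ω‖ = 1) (h : I) :
    ‖phase U p ω h‖ = 1 := by
  rw [phase, norm_mul, hω, one_mul, Complex.norm_natCast_cpow_of_pos p.2.pos]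
  simp

theorem continuous_phase (U : Nat.Primes → Ω → ℂ) (p : Nat.Primes) (ω : Ω) :
    Continuous (phase U p ω) := by
  have h0 : ((p : ℕ) : ℂ) ≠ 0 := by exact_mod_cast p.2.ne_zero
  exact continuous_const.mul (Continuous.const_cpow (by fun_prop) (Or.inl h0))

theorem re_phase_mul_conj_phase {p : Nat.Primes} {ω : Ω} (hω : ‖U p ω‖ = 1) (h h' : I) :
    (phase U p ω h * (starRingEnd ℂ) (phase U p ω h')).re =
      Real.cos (|(h : ℝ) - h'| * Real.log (p : ℕ)) := by
  have h0 : ((p : ℕ) : ℂ) ≠ 0 := by exact_mod_cast p.2.ne_zero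
  have e (x : I) : ((p : ℕ) : ℂ) ^ (-(Complex.I * ((x : ℝ) : ℂ))) =
      Complex.exp (((-(x * Real.log (p : ℕ)) : ℝ) : ℂ) * Complex.I) := by
    rw [Complex.cpow_def_of_ne_zero h0, ← Complex.natCast_log]
    congr 1
    push_cast
    ring
  have e2 : phase U p ω h * (starRingEnd ℂ) (phase U p ω h') = (U p ω * (starRingEnd ℂ) (U p ω)) *
      Complex.exp (((-((h - h') * Real.log (p : ℕ)) : ℝ) : ℂ) * Complex.I) := by
    rw [phase, phase, map_mul, e, e, ← Complex.exp_conj, map_mul, Complex.conj_ofReal,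
      Complex.conj_I, mul_mul_mul_comm, ← Complex.exp_add]
    congr 2
    push_cast
    ring
  rw [e2, Complex.mul_conj, Complex.normSq_eq_norm_sq, hω, one_pow, Complex.ofReal_one, one_mul,
    Complex.exp_ofReal_mul_I_re, Real.cos_neg, ← Real.cos_abs, abs_mul,
    abs_of_nonneg (Real.log_nonneg (by exact_mod_cast p.2.one_le))]

theorem abs_W_le {p : Nat.Primes} {ω : Ω} (hω : ‖U p ω‖ = 1) (h : I) :
    |W U p h ω| ≤ primeWeight p := by
  rw [W_eq_primeWeight_mul, abs_mul, abs_of_nonneg (primeWeight_nonneg p)]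
  exact mul_le_of_le_one_right (primeWeight_nonneg p)
    ((Complex.abs_re_le_norm _).trans (norm_phase hω h).le)

theorem X_rotate {T : ℝ} {p : Nat.Primes} (hp : p ∈ primesLE T) (U : Nat.Primes → Ω → ℂ) (c : ℂ)
    (h : I) (ω : Ω) : X (rotate U p c) T h ω =
      X U T h ω + (W (rotate U p c) p h ω - W U p h ω) := by
  classical
  rw [X, X, ← Finset.add_sum_erase _ _ hp, ← Finset.add_sum_erase (primesLE T)
    (fun p => W U p h ω) hp, Finset.sum_congr rfl fun q hq =>
    W_rotate_of_ne U c (Finset.ne_of_mem_erase hq) h ω]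
  ring

/-- Only the summand of `p` in `X` changes, and successive tilts add. The prime must satisfy `p ≤ T`
to occur in `X` at all. -/
theorem gibbs_rotate {T : ℝ} {p : Nat.Primes} (hp : p ∈ primesLE T) (U : Nat.Primes → Ω → ℂ)
    (β : ℝ) (c : ℂ) (ω : Ω) : gibbs (rotate U p c) β T ω = (gibbs U β T ω).tilted fun h =>
      β * (primeWeight p * (c * phase U p ω h).re - primeWeight p * (phase U p ω h).re) := by
  rw [gibbs_eq_tilted, gibbs_eq_tilted, tilted_tilted (integrable_exp_X U β T ω)]
  congr 1
  ext h
  rw [X_rotate hp, W_rotate_self, W_eq_primeWeight_mul, Pi.add_apply]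
  ring

end Field

/-! ### Gibbs averages of bounded observables and the replica form -/

section Observables

variable {Ω : Type*} [MeasurableSpace Ω] {P : Measure Ω} {U : Nat.Primes → Ω → ℂ}

/-- A jointly measurable observable, almost surely bounded by `B`. -/
structure IsBddObservable (P : Measure Ω) {n : ℕ} (F : (Fin n → I) → Ω → ℝ) (B : ℝ) : Prop where
  measurable : Measurable fun q : (Fin n → I) × Ω => F q.1 q.2
  bound : ∀ᵐ ω ∂P, ∀ h, |F h ω| ≤ B

namespace IsBddObservable

variable {n : ℕ} {F G : (Fin n → I) → Ω → ℝ} {B B' : ℝ}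

theorem measurable_left (hF : IsBddObservable P F B) (ω : Ω) : Measurable fun h => F h ω :=
  hF.measurable.comp (measurable_id.prodMk measurable_const)

theorem integrable [IsProbabilityMeasure P] (hU : ∀ p, Measurable (U p)) (β T : ℝ)
    (hF : IsBddObservable P F B) :
    Integrable (fun ω => ∫ h, F h ω ∂(Measure.pi fun _ : Fin n => gibbs U β T ω)) P := by
  refine .of_bound
    (stronglyMeasurable_integral_pi_gibbs hU β T hF.measurable).aestronglyMeasurable B ?_
  filter_upwards [hF.bound] with ω h1
  exact abs_integral_le_of_abs_le h1

theorem abs_EG_le [IsProbabilityMeasure P] (β T : ℝ) (hF : IsBddObservable P F B) :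
    |EG P U β T n F| ≤ B := by
  have : ∀ᵐ ω ∂P, ‖∫ h, F h ω ∂(Measure.pi fun _ : Fin n => gibbs U β T ω)‖ ≤ B := by
    filter_upwards [hF.bound] with ω h1
    exact abs_integral_le_of_abs_le h1
  simpa [EG] using norm_integral_le_of_norm_le_const this

theorem EG_sum [IsProbabilityMeasure P] (hU : ∀ p, Measurable (U p)) (β T : ℝ) {κ : Type*}
    (S : Finset κ) {F : κ → (Fin n → I) → Ω → ℝ} {B : κ → ℝ}
    (hF : ∀ i ∈ S, IsBddObservable P (F i) (B i)) :
    EG P U β T n (fun h ω => ∑ i ∈ S, F i h ω) = ∑ i ∈ S, EG P U β T n (F i) := by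
  simp only [EG]
  rw [← integral_finsetSum _ fun i hi => (hF i hi).integrable hU β T]
  refine integral_congr_ae ?_
  have hb : ∀ᵐ ω ∂P, ∀ i ∈ S, ∀ h, |F i h ω| ≤ B i :=
    (Finset.eventually_all S).mpr fun i hi => (hF i hi).bound
  filter_upwards [hb] with ω h1
  exact integral_finsetSum _ fun i hi =>
    integrable_of_abs_le ((hF i hi).measurable_left ω) (h1 i hi)

theorem EG_sub [IsProbabilityMeasure P] (hU : ∀ p, Measurable (U p)) (β T : ℝ)
    (hF : IsBddObservable P F B) (hG : IsBddObservable P G B') :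
    EG P U β T n (fun h ω => F h ω - G h ω) = EG P U β T n F - EG P U β T n G := by
  simp only [EG]
  rw [← integral_sub (hF.integrable hU β T) (hG.integrable hU β T)]
  refine integral_congr_ae ?_
  filter_upwards [hF.bound, hG.bound] with ω h1 h2
  exact integral_sub (integrable_of_abs_le (hF.measurable_left ω) h1)
    (integrable_of_abs_le (hG.measurable_left ω) h2)

end IsBddObservable

theorem EG_const_mul (P : Measure Ω) (U : Nat.Primes → Ω → ℂ) (β T : ℝ) {n : ℕ} (c : ℝ)
    (F : (Fin n → I) → Ω → ℝ) :
    EG P U β T n (fun h ω => c * F h ω) = c * EG P U β T n F := by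
  simp only [EG, integral_const_mul]

/-- `∑_l E G^s[A (h_k, h_l) φ] - s E G^{s+1}[A (h_k, h_{s+1}) φ]`. -/
noncomputable def gibbsForm (P : Measure Ω) (U : Nat.Primes → Ω → ℂ) (β T : ℝ) {s : ℕ}
    (A : I → I → ℝ) (k : Fin s) (φ : (Fin s → I) → ℝ) : ℝ :=
  ∑ l, EG P U β T s (fun h _ => A (h k) (h l) * φ h) -
    s * EG P U β T (s + 1)
      (fun h _ => A (h k.castSucc) (h (Fin.last s)) * φ (fun i => h i.castSucc))

section GibbsForm

variable {s : ℕ} {A A' : I → I → ℝ} {φ : (Fin s → I) → ℝ} {K K' M : ℝ}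

theorem measurable_castSucc : Measurable fun (h : Fin (s + 1) → I) (i : Fin s) => h i.castSucc :=
  measurable_pi_lambda _ fun _ => measurable_pi_apply _

theorem isBddObservable_pair (hA : Measurable fun q : I × I => A q.1 q.2)
    (hK : ∀ a b, |A a b| ≤ K) (hφ : Measurable φ) (hM : ∀ h, |φ h| ≤ M) (k l : Fin s) :
    IsBddObservable P (fun h (_ : Ω) => A (h k) (h l) * φ h) (K * M) := by
  have hkl : Measurable fun h : Fin s → I => (h k, h l) :=
    (measurable_pi_apply k).prodMk (measurable_pi_apply l)
  refine ⟨((hA.comp hkl).mul hφ).comp measurable_fst, ae_of_all _ fun ω h => ?_⟩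
  rw [abs_mul]
  exact mul_le_mul (hK _ _) (hM h) (abs_nonneg _) ((abs_nonneg _).trans (hK 0 0))

theorem isBddObservable_pair_last (hA : Measurable fun q : I × I => A q.1 q.2)
    (hK : ∀ a b, |A a b| ≤ K) (hφ : Measurable φ) (hM : ∀ h, |φ h| ≤ M) (k : Fin s) :
    IsBddObservable P (fun (h : Fin (s + 1) → I) (_ : Ω) =>
      A (h k.castSucc) (h (Fin.last s)) * φ (fun i => h i.castSucc)) (K * M) :=
  isBddObservable_pair hA hK (hφ.comp measurable_castSucc) (fun h => hM fun i => h i.castSucc)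
    k.castSucc (Fin.last s)

theorem gibbsForm_eq_integral_replicaForm [IsProbabilityMeasure P] (hU : ∀ p, Measurable (U p))
    (β T : ℝ) (hA : Measurable fun q : I × I => A q.1 q.2) (hK : ∀ a b, |A a b| ≤ K)
    (hφ : Measurable φ) (hM : ∀ h, |φ h| ≤ M) (k : Fin s) :
    Integrable (fun ω => replicaForm (gibbs U β T ω) A k φ) P ∧
    gibbsForm P U β T A k φ = ∫ ω, replicaForm (gibbs U β T ω) A k φ ∂P := by
  have h1 (l : Fin s) := (isBddObservable_pair (P := P) hA hK hφ hM k l).integrable hU β T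
  have h2 := (isBddObservable_pair_last (P := P) hA hK hφ hM k).integrable hU β T
  have h3 := integrable_finsetSum Finset.univ fun l _ => h1 l
  refine ⟨h3.sub (h2.const_mul (s : ℝ)), ?_⟩
  simp only [gibbsForm, replicaForm, EG]
  rw [integral_sub h3 (h2.const_mul (s : ℝ)), integral_finsetSum _ fun l _ => h1 l,
    integral_const_mul]

theorem gibbsForm_const_mul (P : Measure Ω) (U : Nat.Primes → Ω → ℂ) (β T c : ℝ)
    (A : I → I → ℝ) (k : Fin s) (φ : (Fin s → I) → ℝ) :
    gibbsForm P U β T (fun a b => c * A a b) k φ = c * gibbsForm P U β T A k φ := by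
  simp only [gibbsForm, mul_assoc, EG_const_mul, ← Finset.mul_sum]
  ring

theorem gibbsForm_sum [IsProbabilityMeasure P] (hU : ∀ p, Measurable (U p)) (β T : ℝ)
    {κ : Type*} (S : Finset κ) {A : κ → I → I → ℝ} {K : κ → ℝ}
    (hA : ∀ i, Measurable fun q : I × I => A i q.1 q.2) (hK : ∀ i a b, |A i a b| ≤ K i)
    (hφ : Measurable φ) (hM : ∀ h, |φ h| ≤ M) (k : Fin s) :
    gibbsForm P U β T (fun a b => ∑ i ∈ S, A i a b) k φ =
      ∑ i ∈ S, gibbsForm P U β T (A i) k φ := by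
  simp only [gibbsForm, Finset.sum_mul, Finset.sum_sub_distrib, ← Finset.mul_sum]
  rw [IsBddObservable.EG_sum hU β T S fun i _ => isBddObservable_pair_last (hA i) (hK i) hφ hM k,
    Finset.sum_comm]
  congr 1
  exact Finset.sum_congr rfl fun l _ =>
    IsBddObservable.EG_sum hU β T S fun i _ => isBddObservable_pair (hA i) (hK i) hφ hM k l

/-- The form contains `s` averages plus `s` times one more, each moving by at most `D * M`. -/
theorem abs_gibbsForm_sub_le [IsProbabilityMeasure P] (hU : ∀ p, Measurable (U p)) (β T : ℝ)
    (hA : Measurable fun q : I × I => A q.1 q.2) (hK : ∀ a b, |A a b| ≤ K)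
    (hA' : Measurable fun q : I × I => A' q.1 q.2) (hK' : ∀ a b, |A' a b| ≤ K') {D : ℝ}
    (hD : ∀ a b, |A a b - A' a b| ≤ D) (hφ : Measurable φ) (hM : ∀ h, |φ h| ≤ M) (k : Fin s) :
    |gibbsForm P U β T A k φ - gibbsForm P U β T A' k φ| ≤ 2 * s * (D * M) := by
  have e1 (l : Fin s) := IsBddObservable.EG_sub (U := U) hU β T
    (isBddObservable_pair (P := P) hA hK hφ hM k l) (isBddObservable_pair hA' hK' hφ hM k l)
  have e2 := IsBddObservable.EG_sub (U := U) hU β T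
    (isBddObservable_pair_last (P := P) hA hK hφ hM k)
    (isBddObservable_pair_last hA' hK' hφ hM k)
  simp only [← sub_mul] at e1 e2
  have b1 (l : Fin s) := (isBddObservable_pair (P := P) (hA.sub hA') hD hφ hM k l).abs_EG_le
    (U := U) β T
  have b2 := (isBddObservable_pair_last (P := P) (hA.sub hA') hD hφ hM k).abs_EG_le (U := U) β T
  simp only [e1, e2] at b1 b2
  have e : gibbsForm P U β T A k φ - gibbsForm P U β T A' k φ =
      ∑ l, (EG P U β T s (fun h _ => A (h k) (h l) * φ h) -
        EG P U β T s (fun h _ => A' (h k) (h l) * φ h)) -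
      s * (EG P U β T (s + 1) (fun h _ => A (h k.castSucc) (h (Fin.last s)) *
          φ (fun i => h i.castSucc)) -
        EG P U β T (s + 1) (fun h _ => A' (h k.castSucc) (h (Fin.last s)) *
          φ (fun i => h i.castSucc))) := by
    rw [gibbsForm, gibbsForm, Finset.sum_sub_distrib]
    ring
  rw [e]
  refine (abs_sub _ _).trans ?_
  rw [abs_mul, Nat.abs_cast]
  have h1 := (Finset.abs_sum_le_sum_abs _ _).trans (Finset.sum_le_sum fun l (_ : l ∈ Finset.univ) => b1 l)
  rw [Finset.sum_const, Finset.card_univ, Fintype.card_fin, nsmul_eq_mul] at h1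
  have h2 := mul_le_mul_of_nonneg_left b2 (Nat.cast_nonneg (α := ℝ) s)
  linarith

end GibbsForm

/-! ### Integration by parts for one prime -/

section IntegrationByParts

theorem isBddObservable_W (hU : IsIIDUniformCircle P U) (p : Nat.Primes) {s : ℕ} (k : Fin s)
    {φ : (Fin s → I) → ℝ} {M : ℝ} (hφ : Measurable φ) (hM : ∀ h, |φ h| ≤ M) :
    IsBddObservable P (fun h ω => W U p (h k) ω * φ h) (primeWeight p * M) := by
  have hk : Measurable fun q : (Fin s → I) × Ω => (q.1 k, q.2) :=
    ((measurable_pi_apply k).comp measurable_fst).prodMk measurable_snd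
  refine ⟨((measurable_uncurry_W hU.measurable p).comp hk).mul (hφ.comp measurable_fst), ?_⟩
  filter_upwards [hU.ae_norm_eq_one] with ω hω h
  rw [abs_mul]
  exact mul_le_mul (abs_W_le (hω p) _) (hM h) (abs_nonneg _) (primeWeight_nonneg p)

/-- The coordinate family on the space of all realizations of the phases. -/
def coordinate (q : Nat.Primes) (u : Nat.Primes → ℂ) : ℂ := u q

theorem measurable_coordinate (q : Nat.Primes) : Measurable (coordinate q) :=
  measurable_pi_apply q

theorem EG_W_rotate [IsProbabilityMeasure P] (hU : IsIIDUniformCircle P U) (β T : ℝ)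
    (p : Nat.Primes) (j : ℕ) {s : ℕ} (k : Fin s) {φ : (Fin s → I) → ℝ} (hφ : Measurable φ) :
    EG P (rotate U p (Complex.I ^ j)) β T s
      (fun h ω => W (rotate U p (Complex.I ^ j)) p (h k) ω * φ h) =
    EG P U β T s (fun h ω => W U p (h k) ω * φ h) := by
  have hk : Measurable fun q : (Fin s → I) × (Nat.Primes → ℂ) => (q.1 k, q.2) :=
    ((measurable_pi_apply k).comp measurable_fst).prodMk measurable_snd
  have hF : Measurable fun q : (Fin s → I) × (Nat.Primes → ℂ) =>
      W coordinate p (q.1 k) q.2 * φ q.1 :=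
    ((measurable_uncurry_W measurable_coordinate p).comp hk).mul (hφ.comp measurable_fst)
  -- The average is the integral of one measurable functional on the space of realizations,
  -- evaluated along the family; substituting the family for `coordinate` is definitional.
  exact hU.integral_rotate p j (stronglyMeasurable_integral_pi_gibbs measurable_coordinate β T
    (F := fun h u => W coordinate p (h k) u * φ h) hF)

/-- The covariance `cos (|h - h'| log p) / (2 p)` of `W_p(h)` and `W_p(h')`. -/
noncomputable def primeCov (p : Nat.Primes) (a b : I) : ℝ :=
  primeWeight p ^ 2 / 2 * Real.cos (|(a : ℝ) - b| * Real.log (p : ℕ))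

theorem measurable_primeCov (p : Nat.Primes) :
    Measurable fun q : I × I => primeCov p q.1 q.2 := by
  unfold primeCov
  fun_prop

theorem abs_primeCov_le (p : Nat.Primes) (a b : I) :
    |primeCov p a b| ≤ primeWeight p ^ 2 / 2 := by
  rw [primeCov, abs_mul, abs_of_nonneg (by positivity)]
  exact mul_le_of_le_one_right (by positivity) (Real.abs_cos_le_one _)

/-- Approximate Gaussian integration by parts for the contribution of a single prime. -/
theorem abs_EG_W_sub_gibbsForm_le [IsProbabilityMeasure P] (hU : IsIIDUniformCircle P U)
    {β T : ℝ} (hβ : 0 ≤ β) {p : Nat.Primes} (hp : p ∈ primesLE T) {s : ℕ} (k : Fin s)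
    {φ : (Fin s → I) → ℝ} {M : ℝ} (hφ : Measurable φ) (hM : ∀ h, |φ h| ≤ M) :
    |EG P U β T s (fun h ω => W U p (h k) ω * φ h) -
      β * gibbsForm P U β T (primeCov p) k φ| ≤ ibpConst β s M * primeWeight p ^ 3 := by
  obtain ⟨hGi, hG⟩ := gibbsForm_eq_integral_replicaForm (P := P) (U := U) hU.measurable β T
    (measurable_primeCov p) (abs_primeCov_le p) hφ hM k
  have hRi (j : Fin 4) := (isBddObservable_W (hU.rotate p j) p k hφ hM).integrable
    (hU.rotate p j).measurable β T
  have havg : EG P U β T s (fun h ω => W U p (h k) ω * φ h) =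
      ∫ ω, (∑ j : Fin 4, ∫ h, W (rotate U p (Complex.I ^ (j : ℕ))) p (h k) ω * φ h
        ∂(Measure.pi fun _ : Fin s => gibbs (rotate U p (Complex.I ^ (j : ℕ))) β T ω)) / 4 ∂P := by
    have e : ∑ j : Fin 4, EG P (rotate U p (Complex.I ^ (j : ℕ))) β T s
        (fun h ω => W (rotate U p (Complex.I ^ (j : ℕ))) p (h k) ω * φ h) =
        4 * EG P U β T s (fun h ω => W U p (h k) ω * φ h) := by
      rw [Finset.sum_congr rfl fun (j : Fin 4) _ => EG_W_rotate hU β T p j k hφ]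
      simp
    rw [integral_div, integral_finsetSum _ fun j _ => hRi j, eq_div_iff four_ne_zero, mul_comm, ← e]
    rfl
  rw [havg, hG, ← integral_const_mul, ← integral_sub
    ((integrable_finsetSum _ fun j _ => hRi j).div_const 4) (hGi.const_mul β)]
  have hpt : ∀ᵐ ω ∂P, ‖(∑ j : Fin 4, ∫ h, W (rotate U p (Complex.I ^ (j : ℕ))) p (h k) ω * φ h
      ∂(Measure.pi fun _ : Fin s => gibbs (rotate U p (Complex.I ^ (j : ℕ))) β T ω)) / 4 -
        β * replicaForm (gibbs U β T ω) (primeCov p) k φ‖ ≤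
          ibpConst β s M * primeWeight p ^ 3 := by
    filter_upwards [hU.ae_norm_eq_one] with ω hω
    have h1 := abs_sum_integral_rotation_sub_le (μ := gibbs U β T ω)
      (continuous_phase U p ω).measurable (norm_phase (hω p)) hβ (primeWeight_nonneg p)
      (primeWeight_le_one p) k hφ hM
    simp only [re_phase_mul_conj_phase (hω p)] at h1
    simp only [gibbs_rotate hp, W_rotate_self]
    exact h1
  simpa using norm_integral_le_of_norm_le_const hpt

end IntegrationByParts

/-! ### Covariances and the overlap -/

section Covariance

variable [IsProbabilityMeasure P]

theorem integrable_W_mul_W (hU : IsIIDUniformCircle P U) (p q : Nat.Primes) (h h' : I) :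
    Integrable (fun ω => W U p h ω * W U q h' ω) P := by
  have hm (p : Nat.Primes) (h : I) : Measurable (W U p h) :=
    (measurable_uncurry_W hU.measurable p).comp (measurable_const.prodMk measurable_id)
  refine .of_bound ((hm p h).mul (hm q h')).aestronglyMeasurable
    (primeWeight p * primeWeight q) ?_
  filter_upwards [hU.ae_norm_eq_one] with ω hω
  rw [norm_mul]
  exact mul_le_mul (abs_W_le (hω p) h) (abs_W_le (hω q) h') (abs_nonneg _) (primeWeight_nonneg p)

theorem integral_W_mul_W_rotate (hU : IsIIDUniformCircle P U) (p q r : Nat.Primes) (h h' : I)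
    (j : ℕ) : ∫ ω, W (rotate U r (Complex.I ^ j)) p h ω * W (rotate U r (Complex.I ^ j)) q h' ω ∂P =
      ∫ ω, W U p h ω * W U q h' ω ∂P := by
  have hm (p : Nat.Primes) (h : I) : Measurable (W coordinate p h) :=
    (measurable_uncurry_W measurable_coordinate p).comp (measurable_const.prodMk measurable_id)
  exact hU.integral_rotate r j ((hm p h).mul (hm q h')).stronglyMeasurable

theorem integral_W_mul_W_of_ne (hU : IsIIDUniformCircle P U) {p q : Nat.Primes} (hpq : p ≠ q)
    (h h' : I) : ∫ ω, W U p h ω * W U q h' ω ∂P = 0 := by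
  -- Rotation by `i² = -1` flips the sign of `W_p` alone, so the integral equals its own negative.
  have h1 := integral_W_mul_W_rotate hU p q p h h' 2
  have e (ω : Ω) : W (rotate U p (Complex.I ^ 2)) p h ω * W (rotate U p (Complex.I ^ 2)) q h' ω =
      -(W U p h ω * W U q h' ω) := by
    rw [W_rotate_self, W_rotate_of_ne U _ hpq.symm, W_eq_primeWeight_mul U p, Complex.I_sq]
    simp
  simp_rw [e, integral_neg] at h1
  linarith

/-- Summed over the four rotations, the product is almost surely constant. -/
theorem integral_W_mul_W_self (hU : IsIIDUniformCircle P U) (p : Nat.Primes) (h h' : I) :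
    ∫ ω, W U p h ω * W U p h' ω ∂P = primeCov p h h' := by
  have h1 : ∑ j : Fin 4, ∫ ω, W (rotate U p (Complex.I ^ (j : ℕ))) p h ω *
      W (rotate U p (Complex.I ^ (j : ℕ))) p h' ω ∂P = 4 * ∫ ω, W U p h ω * W U p h' ω ∂P := by
    rw [Finset.sum_congr rfl fun (j : Fin 4) _ => integral_W_mul_W_rotate hU p p p h h' j]
    simp
  rw [← integral_finsetSum _ fun (j : Fin 4) _ =>
    integrable_W_mul_W (hU.rotate p j) p p h h'] at h1
  have h2 : ∀ᵐ ω ∂P, ∑ j : Fin 4, W (rotate U p (Complex.I ^ (j : ℕ))) p h ω *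
      W (rotate U p (Complex.I ^ (j : ℕ))) p h' ω = 4 * primeCov p h h' := by
    filter_upwards [hU.ae_norm_eq_one] with ω hω
    have e (j : Fin 4) : W (rotate U p (Complex.I ^ (j : ℕ))) p h ω *
        W (rotate U p (Complex.I ^ (j : ℕ))) p h' ω = primeWeight p ^ 2 *
          ((Complex.I ^ (j : ℕ) * phase U p ω h).re * (Complex.I ^ (j : ℕ) * phase U p ω h').re) := by
      rw [W_rotate_self, W_rotate_self]
      ring
    simp_rw [e, ← Finset.mul_sum]
    rw [sum_re_I_pow_mul_mul_re, re_phase_mul_conj_phase (hω p), primeCov]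
    ring
  rw [integral_congr_ae h2] at h1
  simp at h1
  linarith

theorem sum_primeCov (x : ℝ) (a b : I) :
    ∑ p ∈ primesLE x, primeCov p a b = 1 / 2 * cosSum x |(a : ℝ) - b| := by
  rw [cosSum, Finset.mul_sum]
  refine Finset.sum_congr rfl fun p _ => ?_
  rw [primeCov, primeWeight_sq]
  ring

theorem integral_X_mul_X (hU : IsIIDUniformCircle P U) (T : ℝ) (h h' : I) :
    ∫ ω, X U T h ω * X U T h' ω ∂P = 1 / 2 * cosSum T |(h : ℝ) - h'| := by
  classical
  simp_rw [X, Finset.sum_mul_sum]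
  rw [integral_finsetSum _ fun p _ => integrable_finsetSum _ fun q _ =>
    integrable_W_mul_W hU p q h h', ← sum_primeCov]
  refine Finset.sum_congr rfl fun p hp => ?_
  rw [integral_finsetSum _ fun q _ => integrable_W_mul_W hU p q h h', Finset.sum_eq_single p]
  · exact integral_W_mul_W_self hU p h h'
  · exact fun q _ hq => integral_W_mul_W_of_ne hU hq.symm h h'
  · exact fun h => absurd hp h

theorem overlap_eq (hU : IsIIDUniformCircle P U) (T : ℝ) (h h' : I) :
    overlap P U T h h' = cosSum T |(h : ℝ) - h'| / cosSum T 0 := by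
  have h0 : 0 ≤ cosSum T 0 := Finset.sum_nonneg fun p _ => by simp
  simp only [overlap, sq, integral_X_mul_X hU, sub_self, abs_zero]
  rw [Real.sqrt_mul_self (by linarith), mul_div_mul_left _ _ (by norm_num)]

end Covariance

end Observables

/-! ### Truncated covariance against truncated overlap -/

theorem measurable_cosSum (x : ℝ) : Measurable (cosSum x) := by
  unfold cosSum
  fun_prop

theorem abs_cosSum_le (x δ : ℝ) : |cosSum x δ| ≤ cosSum x 0 := by
  refine (Finset.abs_sum_le_sum_abs _ _).trans (Finset.sum_le_sum fun p _ => ?_)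
  rw [abs_div, Nat.abs_cast, zero_mul, Real.cos_zero]
  gcongr
  exact Real.abs_cos_le_one _

theorem cutoff_eq {α : ℝ} (hα : 0 ≤ α) (r : ℝ) : cutoff α r = min α (max r 0) := by
  have h1 : MeasurableSet {y : ℝ | y < r} := measurableSet_Iio
  rw [cutoff, intervalIntegral.integral_of_le hα, integral_indicator h1,
    Measure.restrict_restrict h1]
  have h2 : ({y : ℝ | y < r} ∩ Set.Ioc 0 α : Set ℝ) =ᵐ[volume] (Set.Ioc 0 (min α r) : Set ℝ) := by
    have : ({y : ℝ | y < r} ∩ Set.Ioc 0 α : Set ℝ) =ᵐ[volume] (Set.Iic r ∩ Set.Ioc 0 α : Set ℝ) :=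
      ae_eq_set_inter Iio_ae_eq_Iic (ae_eq_refl _)
    have e : (Set.Iic r ∩ Set.Ioc 0 α : Set ℝ) = Set.Ioc 0 (min α r) := by
      ext y
      simp only [Set.mem_inter_iff, Set.mem_Iic, Set.mem_Ioc, le_min_iff]
      tauto
    rwa [e] at this
  rw [Measure.restrict_congr_set h2]
  simp only [integral_const, MeasurableSet.univ, measureReal_restrict_apply, Set.univ_inter,
    Real.volume_real_Ioc, sub_zero, smul_eq_mul, mul_one]
  rcases le_total r 0 with h | h
  · rw [max_eq_right (min_le_of_right_le h), max_eq_right h, min_eq_right hα]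
  · rw [max_eq_left (le_min hα h), max_eq_left h]


/-- The truncated covariance is `log log T` times the truncated overlap, up to a bounded error. -/
theorem exists_abs_cosSum_sub_le :
    ∃ C T₀ : ℝ, ∀ T : ℝ, T₀ ≤ T → ∀ α : ℝ, 0 ≤ α → α ≤ 1 →
      1 ≤ Real.log (Real.log T) ∧ Real.exp (Real.log T ^ α) ≤ T ∧
      ∀ δ : ℝ, 0 ≤ δ → δ ≤ 1 →
        |cosSum (Real.exp (Real.log T ^ α)) δ -
          Real.log (Real.log T) * min α (max (cosSum T δ / cosSum T 0) 0)| ≤ C := by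
  obtain ⟨C, hC⟩ := exists_abs_cosSum_add_log_max_le
  have hC0 : 0 ≤ C := (abs_nonneg _).trans (hC (Real.exp 1) 0 le_rfl le_rfl zero_le_one)
  -- The threshold forces `L ≥ 1` and `L ≥ 2C`, the latter giving `V ≥ L/2`. The `5C` is `C` from
  -- the truncated sum plus `4C` from the overlap.
  refine ⟨5 * C, Real.exp (Real.exp (max 1 (2 * C))), fun T hT α hα hα1 => ?_⟩
  have hT0 : 0 < T := (Real.exp_pos _).trans_le hT
  have hlogT : Real.exp (max 1 (2 * C)) ≤ Real.log T := (Real.le_log_iff_exp_le hT0).mpr hT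
  have hlogT0 : 0 < Real.log T := (Real.exp_pos _).trans_le hlogT
  have hL : max 1 (2 * C) ≤ Real.log (Real.log T) :=
    (Real.le_log_iff_exp_le hlogT0).mpr hlogT
  set L := Real.log (Real.log T) with hLdef
  have hL1 : 1 ≤ L := (le_max_left _ _).trans hL
  have hL2 : 2 * C ≤ L := (le_max_right _ _).trans hL
  have hexp : Real.log T = Real.exp L := (Real.exp_log hlogT0).symm
  have hlogT1 : 1 ≤ Real.log T := by rw [hexp]; exact Real.one_le_exp (by linarith)
  have hpow1 : 1 ≤ Real.log T ^ α := Real.one_le_rpow hlogT1 hα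
  have hpowT : Real.log T ^ α ≤ Real.log T := by
    simpa using Real.rpow_le_rpow_of_exponent_le hlogT1 hα1
  refine ⟨hL1, by rwa [← Real.le_log_iff_exp_le hT0], fun δ hδ hδ1 => ?_⟩
  have hTe : Real.exp 1 ≤ T := (Real.le_log_iff_exp_le hT0).mp hlogT1
  set m := -Real.log (max (Real.log T)⁻¹ δ) with hm
  have hinv0 : 0 < (Real.log T)⁻¹ := inv_pos.mpr hlogT0
  have hmax0 : 0 < max (Real.log T)⁻¹ δ := lt_max_of_lt_left hinv0
  have hm0 : 0 ≤ m := by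
    rw [hm, neg_nonneg]
    exact Real.log_nonpos hmax0.le (max_le (inv_le_one_of_one_le₀ hlogT1) hδ1)
  have hmL : m ≤ L := by
    have := Real.log_le_log hinv0 (le_max_left (Real.log T)⁻¹ δ)
    rw [Real.log_inv] at this
    linarith
  have hB := hC T δ hTe hδ hδ1
  have hV := hC T 0 hTe le_rfl zero_le_one
  rw [max_eq_left hinv0.le, Real.log_inv, ← sub_eq_add_neg] at hV
  have hA := hC (Real.exp (Real.log T ^ α)) δ (Real.exp_le_exp.mpr hpow1) hδ hδ1
  rw [Real.log_exp] at hA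
  -- Since `(log T)^(-α) ≥ 1/log T`, replacing `δ` by `max (1/log T) δ` leaves the maximum
  -- unchanged; negated logarithms turn it into a minimum.
  have hmin : -Real.log (max (Real.log T ^ α)⁻¹ δ) = min (α * L) m := by
    have hle : (Real.log T)⁻¹ ≤ (Real.log T ^ α)⁻¹ := inv_anti₀ (by linarith) hpowT
    have e1 : max (Real.log T ^ α)⁻¹ δ = max (Real.log T ^ α)⁻¹ (max (Real.log T)⁻¹ δ) := by
      rw [← max_assoc, max_eq_left hle]
    have hp0 : 0 < (Real.log T ^ α)⁻¹ := hinv0.trans_le hle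
    have e2 : Real.log (Real.log T ^ α)⁻¹ = -(α * L) := by
      rw [Real.log_inv, Real.log_rpow hlogT0]
    rw [e1]
    rcases le_total (Real.log T ^ α)⁻¹ (max (Real.log T)⁻¹ δ) with h | h
    · rw [max_eq_right h, min_eq_right]
      have := Real.log_le_log hp0 h
      linarith
    · rw [max_eq_left h, min_eq_left, e2, neg_neg]
      · have := Real.log_le_log hmax0 h
        linarith
  set A := cosSum (Real.exp (Real.log T ^ α)) δ
  set B := cosSum T δ
  set V := cosSum T 0
  have hVL : L / 2 ≤ V := by
    have := (abs_le.mp hV).1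
    linarith
  have hV0 : 0 < V := by linarith
  have hρ : |L * (B / V) - m| ≤ 4 * C := by
    -- Each of the two numerator terms is at most `L C`, as `0 ≤ m ≤ L`; dividing by `V ≥ L/2` gives
    -- `4C`.
    have e : L * (B / V) - m = (L * (B + Real.log (max (Real.log T)⁻¹ δ)) - m * (V - L)) / V := by
      rw [hm]
      field_simp
      ring
    rw [e, abs_div, abs_of_pos hV0, div_le_iff₀ hV0]
    refine (abs_sub _ _).trans ?_
    rw [abs_mul, abs_mul, abs_of_nonneg (by linarith : 0 ≤ L), abs_of_nonneg hm0]
    have h1 := mul_le_mul_of_nonneg_left hB (by linarith : 0 ≤ L)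
    have h2 := mul_le_mul hmL hV (abs_nonneg _) (by linarith)
    have h3 := mul_le_mul_of_nonneg_left hVL hC0
    linarith
  have hcut : L * min α (max (B / V) 0) = min (α * L) (max (L * (B / V)) 0) := by
    have hL0 : 0 ≤ L := by linarith
    rw [mul_min_of_nonneg _ _ hL0, mul_max_of_nonneg _ _ hL0, mul_zero, mul_comm L α]
  rw [hcut]
  have hA' : |A - min (α * L) m| ≤ C := by
    rw [← hmin, sub_neg_eq_add]
    exact hA
  have hlip : |min (α * L) m - min (α * L) (max (L * (B / V)) 0)| ≤ 4 * C := by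
    have h1 := abs_min_sub_min_le_max (α * L) m (α * L) (max (L * (B / V)) 0)
    have h2 := abs_max_sub_max_le_max m 0 (L * (B / V)) 0
    rw [max_eq_left hm0] at h2
    simp only [sub_self, abs_zero, abs_nonneg, max_eq_left, max_eq_right] at h1 h2
    rw [abs_sub_comm] at hρ
    linarith
  calc _ ≤ |A - min (α * L) m| + |min (α * L) m - min (α * L) (max (L * (B / V)) 0)| :=
        abs_sub_le _ _ _
    _ ≤ _ := by linarith

/-! ### Summation over primes and conclusion -/

/-- Approximate Gaussian integration by parts for the truncated field. -/
theorem abs_EG_truncX_sub_gibbsForm_le {Ω : Type*} [MeasurableSpace Ω] {P : Measure Ω}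
    [IsProbabilityMeasure P] {U : Nat.Primes → Ω → ℂ} (hU : IsIIDUniformCircle P U)
    {β T α : ℝ} (hβ : 0 ≤ β) (hα : Real.exp (Real.log T ^ α) ≤ T) {s : ℕ} (k : Fin s)
    {φ : (Fin s → I) → ℝ} {M : ℝ} (hφ : Measurable φ) (hM : ∀ h, |φ h| ≤ M) :
    |EG P U β T s (fun h ω => truncX U T α (h k) ω * φ h) - β * gibbsForm P U β T
      (fun a b => 1 / 2 * cosSum (Real.exp (Real.log T ^ α)) |(a : ℝ) - b|) k φ| ≤
      ibpConst β s M * ∑' p, primeWeight p ^ 3 := by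
  have hM0 : 0 ≤ M := (abs_nonneg _).trans (hM fun _ => 0)
  simp_rw [truncX, Finset.sum_mul, ← sum_primeCov]
  rw [IsBddObservable.EG_sum hU.measurable β T _ fun p _ => isBddObservable_W hU p k hφ hM,
    gibbsForm_sum hU.measurable β T _ measurable_primeCov abs_primeCov_le hφ hM, Finset.mul_sum,
    ← Finset.sum_sub_distrib]
  have hc : 0 ≤ ibpConst β s M := by rw [ibpConst]; positivity
  calc _ ≤ ∑ p ∈ primesLE (Real.exp (Real.log T ^ α)), ibpConst β s M * primeWeight p ^ 3 := by
        refine (Finset.abs_sum_le_sum_abs _ _).trans (Finset.sum_le_sum fun p hp => ?_)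
        exact abs_EG_W_sub_gibbsForm_le hU hβ
          (mem_primesLE.mpr ((mem_primesLE.mp hp).trans hα)) k hφ hM
    _ ≤ _ := by
        rw [← Finset.mul_sum]
        exact mul_le_mul_of_nonneg_left (summable_primeWeight_pow_three.sum_le_tsum _
          fun p _ => pow_nonneg (primeWeight_nonneg p) 3) hc

end RandomZeta

theorem proposition5p3 (β : ℝ) (hβ : 0 < β) (s : ℕ) (M : ℝ) :
    ∃ C T₀ : ℝ, ∀ (Ω : Type*) [MeasurableSpace Ω] (P : Measure Ω) [IsProbabilityMeasure P]
      (U : Nat.Primes → Ω → ℂ), RandomZeta.IsIIDUniformCircle P U →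
      ∀ T : ℝ, T₀ ≤ T → ∀ α : ℝ, 0 ≤ α → α ≤ 1 → ∀ k : Fin s,
      ∀ φ : (Fin s → unitInterval) → ℝ, Measurable φ → (∀ h, |φ h| ≤ M) →
        |1 / β * (RandomZeta.EG P U β T s (fun h ω => RandomZeta.truncX U T α (h k) ω * φ h) /
              (1 / 2 * Real.log (Real.log T))) -
          (∑ l : Fin s, RandomZeta.EG P U β T s
              (fun h _ => RandomZeta.cutoff α (RandomZeta.overlap P U T (h k) (h l)) * φ h) -
            s * RandomZeta.EG P U β T (s + 1)
              (fun h _ => RandomZeta.cutoff α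
                (RandomZeta.overlap P U T (h k.castSucc) (h (Fin.last s))) *
                  φ (fun i => h i.castSucc)))| ≤
          C * (Real.log (Real.log T))⁻¹ := by
  obtain ⟨C, T₀, hC⟩ := RandomZeta.exists_abs_cosSum_sub_le
  -- The first term is the integration-by-parts error rescaled by `2/β`; the second is the cost of
  -- replacing the covariance by `L` times the cutoff overlap.
  refine ⟨2 / β * (RandomZeta.ibpConst β s M * ∑' p, RandomZeta.primeWeight p ^ 3) +
    2 * s * (C * M), T₀, fun Ω _ P _ U hU T hT α hα hα1 k φ hφ hM => ?_⟩
  obtain ⟨hL1, hx, hδ⟩ := hC T hT α hα hα1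
  have h1 := RandomZeta.abs_EG_truncX_sub_gibbsForm_le hU hβ.le hx k hφ hM
  set L := Real.log (Real.log T)
  set x := Real.exp (Real.log T ^ α)
  set cut : unitInterval → unitInterval → ℝ :=
    fun a b => RandomZeta.cutoff α (RandomZeta.overlap P U T a b) with hcut
  have hcut' (a b : unitInterval) : cut a b = min α (max (RandomZeta.cosSum T |(a : ℝ) - b| /
      RandomZeta.cosSum T 0) 0) := by
    simp only [hcut]
    rw [RandomZeta.cutoff_eq hα, RandomZeta.overlap_eq hU]
  have hdist : Measurable fun q : unitInterval × unitInterval => |(q.1 : ℝ) - q.2| := by fun_prop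
  have hcutm : Measurable fun q : unitInterval × unitInterval => L * cut q.1 q.2 := by
    simp_rw [hcut']
    exact (measurable_const.min ((((RandomZeta.measurable_cosSum T).comp hdist).div_const _).max
      measurable_const)).const_mul L
  have hcutb (a b : unitInterval) : |L * cut a b| ≤ L * 1 := by
    rw [abs_mul, abs_of_nonneg (by linarith : 0 ≤ L), hcut',
      abs_of_nonneg (le_min hα (le_max_right _ _))]
    exact mul_le_mul_of_nonneg_left ((min_le_left _ _).trans hα1) (by linarith)
  have h2 := RandomZeta.abs_gibbsForm_sub_le (P := P) hU.measurable β T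
    ((RandomZeta.measurable_cosSum x).comp hdist)
    (fun a b => RandomZeta.abs_cosSum_le x |(a : ℝ) - b|) hcutm hcutb (D := C)
    (fun a b => by
      rw [hcut']
      exact hδ _ (abs_nonneg _) (abs_le.mpr ⟨by linarith [a.2.1, b.2.2], by linarith [a.2.2, b.2.1]⟩))
    hφ hM k
  rw [RandomZeta.gibbsForm_const_mul] at h1 h2
  change |1 / β * (_ / (1 / 2 * L)) - RandomZeta.gibbsForm P U β T cut k φ| ≤ _
  set E := RandomZeta.EG P U β T s fun h ω => RandomZeta.truncX U T α (h k) ω * φ h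
  set Q := RandomZeta.gibbsForm P U β T (fun a b => RandomZeta.cosSum x |(a : ℝ) - b|) k φ
  set R := RandomZeta.gibbsForm P U β T cut k φ
  have hL0 : 0 < L := by linarith
  -- The form `Q` of the true covariance is inserted as an intermediate term, separating the two
  -- errors over a common factor `1/L`.
  have e : 1 / β * (E / (1 / 2 * L)) - R =
      (2 / β * (E - β * (1 / 2 * Q)) + (Q - L * R)) * L⁻¹ := by
    field_simp
    ring
  rw [e, abs_mul, abs_of_pos (inv_pos.mpr hL0)]
  refine mul_le_mul_of_nonneg_right ((abs_add_le _ _).trans (add_le_add ?_ h2)) (by positivity)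
  rw [abs_mul, abs_of_pos (by positivity : 0 < 2 / β)]
  exact mul_le_mul_of_nonneg_left h1 (by positivity)
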